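/- For $\alpha,\beta,x\in\mathbb C$ let $$P(x)=P(\alpha,\beta;x)=\frac{\Gamma\left(\frac{x-\alpha+1}{2}\right)\Gamma\left(\frac{x+\alpha+\beta+1}{2}\right)\Gamma\left(\frac{x-\beta+1}{2}\right)}{\Gamma\left(\frac{x+\alpha+1}{2}\right)\Gamma\left(\frac{x-\alpha-\beta+1}{2}\right)\Gamma\left(\frac{x+\beta+1}{2}\right)},$$ and assume that $\operatorname{Re}(x)>0$, or that at least one of $\alpha$, $\beta$, $\alpha+\beta$ is an even integer. Put $\sigma=\alpha\beta(\alpha+\beta)/4$, $b_0(x)=x^2-1-\sigma$ and, for $m\ge 1$, $$a_{2m}=\tfrac14(2m+\alpha)(2m-\alpha-\beta)(2m+\beta),\qquad a_{2m-1}=\tfrac14(2m-\alpha)(2m+\alpha+\beta)(2m-\beta),$$ $$b_{2m}(x)=(x^2-1)(2m+1),\qquad b_{2m-1}(x)=1,$$ $$\kappa_m=-\frac{\left((2m)^2-\alpha^2\right)\left((2m)^2-(\alpha+\beta)^2\right)\left((2m)^2-\beta^2\right)}{16(2m-1)(2m+1)},$$ and, for $m\ge 0$, $\lambda_m=\frac12\left(4m^2+4m+2-\alpha^2-\alpha\beta-\beta^2\right)$.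 Suppose that the meromorphic function $\frac{1-P}{1+P}$ of the variable $x$ has no pole at the given point $x$. Then its value there is $$\frac{1-P(x)}{1+P(x)}=\cfrac{\sigma}{x^2+\lambda_0+\cfrac{\kappa_1}{x^2+\lambda_1+\cfrac{\kappa_2}{x^2+\lambda_2+\cdots}}},$$ and, provided that $x\ne 1$ or that at least one of $\alpha,\beta,\alpha+\beta$ is an even integer, also $$\frac{1-P(x)}{1+P(x)}=\cfrac{\sigma}{b_0(x)+\cfrac{a_1}{b_1(x)+\cfrac{a_2}{b_2(x)+\cdots}}}.$$ Here the value of a continued fraction is the limit of its approximants $A_n/B_n$ (the quotients of its continuants), which are part of the claim to be defined for all large $n$ and to converge; a continued fraction whose partial numerators include a zero is terminated just before the first such numerator (so it is $0$ if $\sigma=0$). -/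

import Mathlib

open Filter Topology

noncomputable section

/-- The quotient of gamma functions `P(a; x)` with `a = (α, β)`.
Where only a denominator factor has a pole, Mathlib's value `Gamma (-n) = 0` and division by zero
give `0`, which is the correct value of the quotient. -/
def gammaQuot (α β x : ℂ) : ℂ :=
  (Complex.Gamma ((x - α + 1) / 2) * Complex.Gamma ((x + α + β + 1) / 2)
      * Complex.Gamma ((x - β + 1) / 2)) /
    (Complex.Gamma ((x + α + 1) / 2) * Complex.Gamma ((x - α - β + 1) / 2)
      * Complex.Gamma ((x + β + 1) / 2))

/-- `v` is the (finite) value at `x` of the meromorphic function given by `f` near `x`.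
At a point where `f` is continuous this says `v = f x`; at a removable singularity `v` is the value
of the continuation; there is no such `v` at a pole. -/
def HasMeromorphicValue (f : ℂ → ℂ) (x v : ℂ) : Prop :=
  Tendsto f (𝓝[≠] x) (𝓝 v)

/-- The generalized continued fraction `a 0 / (b 0 + a 1 / (b 1 + a 2 / (b 2 + ⋯)))`, which
terminates just before its first vanishing partial numerator (and is `0` if `a 0 = 0`). -/
def contFrac (a b : ℕ → ℂ) : GenContFract ℂ where
  h := 0
  s := ⟨fun n => open Classical in
      if ∀ k ≤ n, a k ≠ 0 then some ⟨a n, b n⟩ else none, by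
    intro n hn
    by_cases h : ∀ k ≤ n, a k ≠ 0
    · exact absurd ((if_pos h).symm.trans hn) (by simp)
    · have h' : ¬ ∀ k ≤ n + 1, a k ≠ 0 := fun H => h fun k hk => H k (by omega)
      exact if_neg h'⟩

/-- The approximants `Aₙ / Bₙ` of `g` are eventually defined and converge to `v`. -/
def HasValue (g : GenContFract ℂ) (v : ℂ) : Prop :=
  (∀ᶠ n in atTop, g.dens n ≠ 0) ∧ Tendsto g.convs atTop (𝓝 v)

/-- The leading numerator `αβ(α+β)/4`. -/
def leadNum (α β : ℂ) : ℂ := α * β * (α + β) / 4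

/-- Partial numerators of the first fraction. At index `0`: the leading one; for `n = 2m` and
`n = 2m - 1` with `m ≥ 1`: `a_{2m} = (2m+α)(2m-α-β)(2m+β)/4` and
`a_{2m-1} = (2m-α)(2m+α+β)(2m-β)/4`. -/
def aCoeff (α β : ℂ) (n : ℕ) : ℂ :=
  if n = 0 then leadNum α β
  else if Even n then (n + α) * (n - α - β) * (n + β) / 4
  else ((n + 1 : ℂ) - α) * ((n + 1 : ℂ) + α + β) * ((n + 1 : ℂ) - β) / 4

/-- Partial denominators of the first fraction: `b_0 = x² - 1 - αβ(α+β)/4` and, for `m ≥ 1`,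
`b_{2m} = (x² - 1)(2m + 1)` and `b_{2m-1} = 1`. -/
def bCoeff (α β x : ℂ) (n : ℕ) : ℂ :=
  if n = 0 then x ^ 2 - 1 - leadNum α β
  else if Even n then (x ^ 2 - 1) * (n + 1)
  else 1

/-- Partial numerators of the second fraction: the leading one at index `0`, and `κ_m` for
`m ≥ 1`. -/
def kappa (α β : ℂ) (m : ℕ) : ℂ :=
  if m = 0 then leadNum α β
  else -((((2 * m : ℂ) ^ 2 - α ^ 2) * ((2 * m : ℂ) ^ 2 - (α + β) ^ 2)
      * ((2 * m : ℂ) ^ 2 - β ^ 2)) / (16 * (2 * m - 1) * (2 * m + 1)))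

/-- `λ_m`, for `m ≥ 0`. -/
def lam (α β : ℂ) (m : ℕ) : ℂ :=
  (4 * (m : ℂ) ^ 2 + 4 * m + 2 - α ^ 2 - α * β - β ^ 2) / 2

/-- `z` is an even integer. -/
def IsEvenInt (z : ℂ) : Prop := ∃ k : ℤ, z = 2 * (k : ℂ)

end

/-! Write `Q⁺` and `Q⁻` for `invGammaProd` at `(α, β)` and `(-α, -β)`. Both are entire in `x`, and
`P = Q⁺ / Q⁻`, so the function to expand is `(Q⁻ - Q⁺) / (Q⁻ + Q⁺)`.

Let `Aₙ / Bₙ` be the approximants of the second fraction. Up to an explicit scale, `Bₙ - Aₙ` is a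
Wilson polynomial, realized as the `n`-th Taylor coefficient of a product of two Gauss functions
(`cauchyProduct_recurrence`, `kDen_sub_kNum`). For `Re x > 0` the coefficients of one factor behave
like `n ^ (x - 1)` and those of the other are absolutely summable. The coefficients of the product
therefore behave like `n ^ (x - 1)` times a sum that Gauss's theorem evaluates
(`tendsto_cauchyProduct`, `tsum_gaussCoeff`); the constant is `Q⁺` times a nonzero factor free of
`α, β`. Under `(α, β) ↦ (-α, -β)` only the leading numerator changes sign, so `Aₙ` is odd and `Bₙ`
even, and `Bₙ + Aₙ` has the same asymptotics with `Q⁻`. Hence `Aₙ / Bₙ` tends to the required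
quotient whenever `Q⁻ + Q⁺ ≠ 0`. At a point with `Re x > 0` that is not a pole, this sum can vanish
only if `α`, `β` or `α + β` is even.

In the even case some `κ_N` vanishes. Then `(Q⁻ - Q⁺) B_N = (Q⁻ + Q⁺) A_N` follows for `Re x > 0`
from the same asymptotics, and for all `x` because both sides are entire; the determinant formula
gives `B_N ≠ 0`.

The even part of the first fraction is the second fraction (`even_contraction`). Its odd continuants
solve a first order recurrence driven by the even ones, and their normalized limits carry a common
factor `2 (x - 1)` (`tendsto_odd_continuant`), so for `x ≠ 1` the odd approximants have the same
limit. -/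

/-! ### Rising factorials and the growth of the gamma function -/

/-- The rising factorial `s (s + 1) ⋯ (s + n - 1)`. -/
noncomputable def rising (s : ℂ) (n : ℕ) : ℂ := ∏ j ∈ Finset.range n, (s + j)

theorem rising_zero (s : ℂ) : rising s 0 = 1 := by simp [rising]

theorem rising_succ (s : ℂ) (n : ℕ) : rising s (n + 1) = rising s n * (s + n) := by
  simp [rising, Finset.prod_range_succ]

theorem rising_mul_inv_Gamma (s : ℂ) (n : ℕ) :
    rising s n * (Complex.Gamma (s + n))⁻¹ = (Complex.Gamma s)⁻¹ := by
  induction n with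
  | zero => simp [rising_zero]
  | succ n ih =>
    rw [rising_succ, mul_assoc, ← ih, Complex.one_div_Gamma_eq_self_mul_one_div_Gamma_add_one (s + n)]
    push_cast
    ring_nf

theorem tendsto_add_natCast_div (s : ℂ) :
    Tendsto (fun n : ℕ => (s + n) / (n : ℂ)) atTop (𝓝 1) := by
  have h : Tendsto (fun n : ℕ => s / (n : ℂ) + 1) atTop (𝓝 (0 + 1)) :=
    (tendsto_const_div_atTop_nhds_zero_nat s).add_const 1
  rw [zero_add] at h
  refine h.congr' ?_
  filter_upwards [eventually_ne_atTop 0] with n hn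
  have : (n : ℂ) ≠ 0 := Nat.cast_ne_zero.mpr hn
  field_simp

theorem natCast_cpow_add {n : ℕ} (hn : n ≠ 0) (s t : ℂ) :
    (n : ℂ) ^ (s + t) = (n : ℂ) ^ s * (n : ℂ) ^ t :=
  Complex.cpow_add _ _ (Nat.cast_ne_zero.mpr hn)

/-- For `Re s > 0` this is Euler's limit `GammaSeq`. The functional equation of `1 / Γ` carries it
to the left one unit at a time, so no value of `s` is exceptional. -/
theorem tendsto_factorial_mul_cpow_mul_inv_Gamma (s : ℂ) :
    Tendsto (fun n : ℕ => (n.factorial : ℂ) * (n : ℂ) ^ (s - 1) * (Complex.Gamma (s + n))⁻¹)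
      atTop (𝓝 1) := by
  have key : ∀ (m : ℕ) (s : ℂ), -(m : ℝ) < s.re →
      Tendsto (fun n : ℕ => (n.factorial : ℂ) * (n : ℂ) ^ (s - 1) * (Complex.Gamma (s + n))⁻¹)
        atTop (𝓝 1) := by
    intro m
    induction m with
    | zero =>
      intro s hs
      have hs : 0 < s.re := by simpa using hs
      have hG := Complex.Gamma_ne_zero_of_re_pos hs
      have h1 := ((Complex.GammaSeq_tendsto_Gamma s).div_const (Complex.Gamma s)).mul
        (tendsto_add_natCast_div s)
      rw [div_self hG, one_mul] at h1
      refine h1.congr' ?_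
      filter_upwards [eventually_ne_atTop 0] with n hn
      have hn' : (n : ℂ) ≠ 0 := Nat.cast_ne_zero.mpr hn
      have hsn : ∀ j : ℕ, s + j ≠ 0 := by
        intro j h
        have := congrArg Complex.re h
        simp at this
        have : (0 : ℝ) ≤ j := Nat.cast_nonneg j
        linarith
      have hr : ∏ j ∈ Finset.range n, (s + j) ≠ 0 := Finset.prod_ne_zero_iff.mpr fun j _ => hsn j
      have h2 := rising_mul_inv_Gamma s n
      have h3 : (Complex.Gamma (s + n))⁻¹ = (Complex.Gamma s)⁻¹ / ∏ j ∈ Finset.range n, (s + j) := by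
        rw [eq_div_iff hr, ← h2, rising, mul_comm]
      rw [h3, Complex.GammaSeq, Finset.prod_range_succ, Complex.cpow_sub _ _ hn', Complex.cpow_one]
      have := hsn n
      field_simp
    | succ m ih =>
      intro s hs
      have h1 := (ih (s + 1) (by simp at hs ⊢; linarith)).mul (tendsto_add_natCast_div s)
      rw [one_mul] at h1
      refine h1.congr' ?_
      filter_upwards [eventually_ne_atTop 0] with n hn
      have hn' : (n : ℂ) ≠ 0 := Nat.cast_ne_zero.mpr hn
      rw [Complex.one_div_Gamma_eq_self_mul_one_div_Gamma_add_one (s + n), add_sub_cancel_right,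
        Complex.cpow_sub _ _ hn', Complex.cpow_one, add_right_comm s 1]
      field_simp
  obtain ⟨m, hm⟩ := exists_nat_gt (-s.re)
  exact key m s (by linarith)

theorem tendsto_rising_div (s : ℂ) :
    Tendsto (fun n : ℕ => rising s n / ((n.factorial : ℂ) * (n : ℂ) ^ (s - 1)))
      atTop (𝓝 (Complex.Gamma s)⁻¹) := by
  have h := tendsto_factorial_mul_cpow_mul_inv_Gamma s
  have h1 := (tendsto_const_nhds (x := (Complex.Gamma s)⁻¹)).mul (h.inv₀ one_ne_zero)
  rw [inv_one, mul_one] at h1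
  refine h1.congr' ?_
  filter_upwards [h.eventually_ne one_ne_zero] with n hn
  rw [← rising_mul_inv_Gamma s n]
  have h2 := right_ne_zero_of_mul hn
  have h3 := left_ne_zero_of_mul hn
  have h4 : Complex.Gamma (s + n) ≠ 0 := fun h0 => by simp [h0] at h2
  rw [mul_inv]
  field_simp

/-! ### Gauss functions and Gauss's summation theorem -/

/-- The Taylor coefficients of the regularized Gauss function `₂F₁(p, q; r) / Γ(r)`. -/
noncomputable def gaussCoeff (p q r : ℂ) (n : ℕ) : ℂ :=
  rising p n * rising q n / n.factorial * (Complex.Gamma (r + n))⁻¹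

theorem gaussCoeff_succ (p q r : ℂ) (n : ℕ) :
    (n + 1) * (r + n) * gaussCoeff p q r (n + 1) = (p + n) * (q + n) * gaussCoeff p q r n := by
  have h := Complex.one_div_Gamma_eq_self_mul_one_div_Gamma_add_one (r + n)
  have hn : ((n : ℂ) + 1) ≠ 0 := Nat.cast_add_one_ne_zero n
  have hf : (n.factorial : ℂ) ≠ 0 := Nat.cast_ne_zero.mpr n.factorial_ne_zero
  rw [gaussCoeff, gaussCoeff, rising_succ, rising_succ, Nat.factorial_succ, h, ← add_assoc r n 1 |>.symm]
  push_cast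
  rw [← add_assoc r (n : ℂ) 1]
  field_simp

theorem gaussCoeff_eq_add_one (p q r : ℂ) (n : ℕ) :
    gaussCoeff p q r n = (r + n) * gaussCoeff p q (r + 1) n := by
  rw [gaussCoeff, gaussCoeff, Complex.one_div_Gamma_eq_self_mul_one_div_Gamma_add_one (r + n),
    add_right_comm r 1]
  ring

theorem tendsto_gaussCoeff (p q r : ℂ) :
    Tendsto (fun n : ℕ => gaussCoeff p q r n * (n : ℂ) ^ (1 + r - p - q)) atTop
      (𝓝 ((Complex.Gamma p)⁻¹ * (Complex.Gamma q)⁻¹)) := by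
  have h := ((tendsto_rising_div p).mul (tendsto_rising_div q)).mul
    (tendsto_factorial_mul_cpow_mul_inv_Gamma r)
  rw [mul_one] at h
  refine h.congr' ?_
  filter_upwards [eventually_ne_atTop 0] with n hn
  have hn' : (n : ℂ) ≠ 0 := Nat.cast_ne_zero.mpr hn
  have hf : (n.factorial : ℂ) ≠ 0 := Nat.cast_ne_zero.mpr n.factorial_ne_zero
  have hp : (n : ℂ) ^ (p - 1) ≠ 0 := by simp [Complex.cpow_eq_zero_iff, hn']
  have hq : (n : ℂ) ^ (q - 1) ≠ 0 := by simp [Complex.cpow_eq_zero_iff, hn']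
  have h1 : (n : ℂ) ^ (r - 1) = (n : ℂ) ^ (1 + r - p - q) * (n : ℂ) ^ (p - 1) * (n : ℂ) ^ (q - 1) := by
    rw [← natCast_cpow_add hn, ← natCast_cpow_add hn]
    ring_nf
  rw [h1, gaussCoeff]
  field_simp

/-- A sequence with a limit at the scale `n ^ s` is bounded at that scale. -/
theorem exists_bound_of_tendsto_mul_cpow {u : ℕ → ℂ} {s U : ℂ}
    (h : Tendsto (fun n : ℕ => u n * (n : ℂ) ^ s) atTop (𝓝 U)) :
    ∃ C : ℝ, 0 < C ∧ ∀ n, ‖u n‖ ≤ C * ((n : ℝ) + 1) ^ (-s.re) := by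
  have h1 : Tendsto (fun n : ℕ => ‖u n * (n : ℂ) ^ s‖ * ((1 : ℝ) + 1 / n) ^ s.re) atTop
      (𝓝 (‖U‖ * (1 + 0) ^ s.re)) := by
    refine h.norm.mul (Tendsto.rpow_const ?_ (Or.inl (by norm_num)))
    exact tendsto_const_nhds.add tendsto_one_div_atTop_nhds_zero_nat
  have h2 : Tendsto (fun n : ℕ => ‖u n‖ * ((n : ℝ) + 1) ^ s.re) atTop
      (𝓝 (‖U‖ * (1 + 0) ^ s.re)) := by
    refine h1.congr' ?_
    filter_upwards [eventually_gt_atTop 0] with n hn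
    have hn' : (0 : ℝ) < n := Nat.cast_pos.mpr hn
    rw [norm_mul, Complex.norm_natCast_cpow_of_pos hn, mul_assoc,
      ← Real.mul_rpow hn'.le (by positivity)]
    congr 2
    field_simp
  obtain ⟨C, hC⟩ := h2.bddAbove_range
  refine ⟨max C 1, by positivity, fun n => ?_⟩
  have h3 : ‖u n‖ * ((n : ℝ) + 1) ^ s.re ≤ max C 1 := (hC ⟨n, rfl⟩).trans (le_max_left _ _)
  rw [Real.rpow_neg (by positivity), ← div_eq_mul_inv, le_div_iff₀ (by positivity)]
  exact h3

theorem exists_gaussCoeff_bound (p q r : ℂ) :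
    ∃ C : ℝ, 0 < C ∧ ∀ n, ‖gaussCoeff p q r n‖ ≤ C * ((n : ℝ) + 1) ^ (p.re + q.re - r.re - 1) := by
  obtain ⟨C, hC, h⟩ := exists_bound_of_tendsto_mul_cpow (tendsto_gaussCoeff p q r)
  refine ⟨C, hC, fun n => (h n).trans_eq ?_⟩
  simp
  left
  ring_nf

theorem summable_natCast_add_one_rpow {s : ℝ} (hs : s < -1) :
    Summable fun n : ℕ => ((n : ℝ) + 1) ^ s := by
  have := (summable_nat_add_iff 1).mpr (Real.summable_nat_rpow.mpr hs)
  simpa using this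

theorem summable_gaussCoeff {p q r : ℂ} (h : 0 < (r - p - q).re) :
    Summable (gaussCoeff p q r) := by
  obtain ⟨C, hC, hb⟩ := exists_gaussCoeff_bound p q r
  refine Summable.of_norm_bounded ((summable_natCast_add_one_rpow ?_).mul_left C) hb
  simp at h
  linarith

/-- The corresponding combination of partial sums telescopes to `n * gaussCoeff p q r n`, which
tends to `0`. -/
theorem tsum_gaussCoeff_add_one {p q r : ℂ} (h : 0 < (r - p - q).re) :
    (r - p) * (r - q) * ∑' n, gaussCoeff p q (r + 1) n
      = (r - p - q) * ∑' n, gaussCoeff p q r n := by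
  have h' : 0 < (r + 1 - p - q).re := by simp at h ⊢; linarith
  have h1 := ((summable_gaussCoeff h').hasSum.tendsto_sum_nat.const_mul ((r - p) * (r - q))).sub
    ((summable_gaussCoeff h).hasSum.tendsto_sum_nat.const_mul (r - p - q))
  have h2 : ∀ n : ℕ, (r - p) * (r - q) * ∑ j ∈ Finset.range n, gaussCoeff p q (r + 1) j
      - (r - p - q) * ∑ j ∈ Finset.range n, gaussCoeff p q r j = n * gaussCoeff p q r n := by
    intro n
    induction n with
    | zero => simp
    | succ n ih =>
      have e1 := gaussCoeff_succ p q r n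
      have e2 := gaussCoeff_eq_add_one p q r n
      have e3 := gaussCoeff_eq_add_one p q r (n + 1)
      have e4 := gaussCoeff_succ p q (r + 1) n
      rw [Finset.sum_range_succ, Finset.sum_range_succ]
      push_cast at e3 ⊢
      rw [e2] at ih ⊢
      rw [e3]
      linear_combination ih - e4
  have h3 : Tendsto (fun n : ℕ => (n : ℂ) * gaussCoeff p q r n) atTop (𝓝 0) := by
    obtain ⟨C, hC, hb⟩ := exists_gaussCoeff_bound p q r
    have h4 : Tendsto (fun n : ℕ => C * ((n : ℝ) + 1) ^ (-(r - p - q).re)) atTop (𝓝 (C * 0)) :=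
      ((tendsto_rpow_neg_atTop h).comp
        (tendsto_atTop_add_const_right _ 1 tendsto_natCast_atTop_atTop)).const_mul C
    rw [mul_zero] at h4
    refine squeeze_zero_norm (fun n => ?_) h4
    rw [norm_mul, Complex.norm_natCast]
    have hn : (0 : ℝ) < (n : ℝ) + 1 := by positivity
    calc (n : ℝ) * ‖gaussCoeff p q r n‖
        ≤ ((n : ℝ) + 1) * (C * ((n : ℝ) + 1) ^ (p.re + q.re - r.re - 1)) :=
          mul_le_mul (by linarith) (hb n) (norm_nonneg _) hn.le
      _ = C * ((n : ℝ) + 1) ^ (-(r - p - q).re) := by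
          rw [show -(r - p - q).re = (p.re + q.re - r.re - 1) + 1 by simp; ring,
            Real.rpow_add_one hn.ne']
          ring
  have h5 := tendsto_nhds_unique (h1.congr h2) h3
  linear_combination h5

theorem rising_mul_tsum_gaussCoeff {p q r : ℂ} (h : 0 < (r - p - q).re) (m : ℕ) :
    rising (r - p) m * rising (r - q) m * ∑' n, gaussCoeff p q (r + m) n
      = rising (r - p - q) m * ∑' n, gaussCoeff p q r n := by
  induction m with
  | zero => simp [rising_zero]
  | succ m ih =>
    have hm : 0 < (r + m - p - q).re := by
      have : (0 : ℝ) ≤ m := Nat.cast_nonneg m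
      simp at h ⊢; linarith
    have e := tsum_gaussCoeff_add_one hm
    rw [rising_succ, rising_succ, rising_succ]
    push_cast
    rw [← add_assoc]
    linear_combination rising (r - p) m * rising (r - q) m * e + (r - p - q + m) * ih

theorem norm_rising_le (p : ℂ) (n : ℕ) : ‖rising p n‖ ≤ ‖rising (‖p‖ : ℝ) n‖ := by
  rw [rising, rising, norm_prod, norm_prod]
  refine Finset.prod_le_prod (fun _ _ => norm_nonneg _) fun j _ => ?_
  have : ‖((‖p‖ : ℝ) : ℂ) + j‖ = ‖p‖ + j := by
    rw [← Complex.ofReal_natCast, ← Complex.ofReal_add, Complex.norm_real, Real.norm_eq_abs,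
      abs_of_nonneg (by positivity)]
  rw [this]
  exact (norm_add_le _ _).trans_eq (by simp)

theorem norm_rising_le_of_le_re {R : ℝ} {s : ℂ} (hR : 0 ≤ R) (h : R ≤ s.re) (n : ℕ) :
    ‖rising R n‖ ≤ ‖rising s n‖ := by
  rw [rising, rising, norm_prod, norm_prod]
  refine Finset.prod_le_prod (fun _ _ => norm_nonneg _) fun j _ => ?_
  have : ‖(R : ℂ) + j‖ = R + j := by
    rw [← Complex.ofReal_natCast, ← Complex.ofReal_add, Complex.norm_real, Real.norm_eq_abs,
      abs_of_nonneg (by positivity)]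
  rw [this]
  refine le_trans ?_ (Complex.re_le_norm _)
  simpa using h

theorem rising_ne_zero_of_re_pos {s : ℂ} (hs : 0 < s.re) (n : ℕ) : rising s n ≠ 0 := by
  refine Finset.prod_ne_zero_iff.mpr fun j _ h => ?_
  have := congrArg Complex.re h
  simp at this
  have : (0 : ℝ) ≤ j := Nat.cast_nonneg j
  linarith

theorem gaussCoeff_mul_Gamma {r : ℂ} (hr : 0 < r.re) (p q : ℂ) (n : ℕ) :
    gaussCoeff p q r n * Complex.Gamma r
      = rising p n * rising q n / n.factorial / rising r n := by
  have h1 := rising_mul_inv_Gamma r n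
  have h2 := rising_ne_zero_of_re_pos hr n
  have h3 := Complex.Gamma_ne_zero_of_re_pos hr
  have h4 : (Complex.Gamma (r + n))⁻¹ = (Complex.Gamma r)⁻¹ / rising r n := by
    rw [eq_div_iff h2, ← h1, mul_comm]
  rw [gaussCoeff, h4]
  field_simp

theorem tendsto_tsum_gaussCoeff_mul_Gamma (p q r : ℂ) :
    Tendsto (fun m : ℕ => (∑' n, gaussCoeff p q (r + m) n) * Complex.Gamma (r + m)) atTop
      (𝓝 1) := by
  -- The series with parameters `‖p‖, ‖q‖; R` dominates all those with `Re (r + m) ≥ R`, and it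
  -- converges since `R - ‖p‖ - ‖q‖ = 1 > 0`.
  set R : ℝ := ‖p‖ + ‖q‖ + 1 with hR
  have hR0 : 0 < R := by positivity
  have hRr : ∀ᶠ m : ℕ in atTop, R ≤ (r + m).re := by
    filter_upwards [eventually_ge_atTop ⌈R - r.re⌉₊] with m hm
    have := Nat.ceil_le.mp hm
    simp
    linarith
  have hsum : Summable fun n => ‖gaussCoeff (‖p‖ : ℝ) (‖q‖ : ℝ) R n * Complex.Gamma R‖ := by
    refine ((summable_gaussCoeff ?_).mul_right _).norm
    simp [hR]
    linarith
  -- The product of zeros is `1` for `n = 0` and `0` otherwise: only the constant term survives.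
  have hpt : ∀ n : ℕ, Tendsto (fun m : ℕ => gaussCoeff p q (r + m) n * Complex.Gamma (r + m)) atTop
      (𝓝 (rising p n * rising q n / n.factorial * ∏ _j ∈ Finset.range n, (0 : ℂ))) := by
    intro n
    have h1 : Tendsto (fun m : ℕ => ∏ j ∈ Finset.range n, (r + m + j)⁻¹) atTop
        (𝓝 (∏ _j ∈ Finset.range n, (0 : ℂ))) := by
      refine tendsto_finsetProd _ fun j _ => ?_
      refine tendsto_inv₀_cobounded.comp ?_
      rw [← tendsto_norm_atTop_iff_cobounded]
      refine tendsto_atTop_mono (fun m => Complex.re_le_norm _) ?_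
      have : (fun m : ℕ => (r + m + j).re) = fun m : ℕ => (m : ℝ) + (r.re + j) := by
        funext m; simp; ring
      rw [this]
      exact tendsto_atTop_add_const_right _ _ tendsto_natCast_atTop_atTop
    refine (h1.const_mul _).congr' ?_
    filter_upwards [hRr] with m hm
    rw [gaussCoeff_mul_Gamma (hR0.trans_le hm), Finset.prod_inv_distrib, rising, rising, rising]
    rfl
  have hb : ∀ᶠ m : ℕ in atTop, ∀ n, ‖gaussCoeff p q (r + m) n * Complex.Gamma (r + m)‖
      ≤ ‖gaussCoeff (‖p‖ : ℝ) (‖q‖ : ℝ) R n * Complex.Gamma R‖ := by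
    filter_upwards [hRr] with m hm n
    have hRre : 0 < (R : ℂ).re := by simpa using hR0
    rw [gaussCoeff_mul_Gamma (hR0.trans_le hm), gaussCoeff_mul_Gamma hRre]
    simp only [norm_div, norm_mul]
    have := norm_pos_iff.mpr (rising_ne_zero_of_re_pos hRre n)
    gcongr
    · exact norm_rising_le p n
    · exact norm_rising_le q n
    · exact norm_rising_le_of_le_re hR0.le hm n
  have h := tendsto_tsum_of_dominated_convergence hsum hpt hb
  have h0 : ∑' n : ℕ, (rising p n * rising q n / n.factorial * ∏ _j ∈ Finset.range n, (0 : ℂ)) = 1 := by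
    rw [tsum_eq_single 0]
    · simp [rising_zero]
    · intro n hn
      simp [hn]
  rw [h0] at h
  refine h.congr fun m => tsum_mul_right

/-- Gauss's summation theorem. -/
theorem tsum_gaussCoeff {p q r : ℂ} (h : 0 < (r - p - q).re) :
    ∑' n, gaussCoeff p q r n
      = Complex.Gamma (r - p - q) * (Complex.Gamma (r - p))⁻¹ * (Complex.Gamma (r - q))⁻¹ := by
  -- The contiguous relation iterated `m` times is divided by its common growth in `m`, and `m → ∞`.
  have h1 := (((tendsto_rising_div (r - p)).mul (tendsto_rising_div (r - q))).mul
    (tendsto_tsum_gaussCoeff_mul_Gamma p q r)).mul (tendsto_factorial_mul_cpow_mul_inv_Gamma r)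
  have h2 := (tendsto_rising_div (r - p - q)).mul_const (∑' n, gaussCoeff p q r n)
  have h3 := tendsto_nhds_unique (h2.congr' ?_) h1
  · have hG := Complex.Gamma_ne_zero_of_re_pos h
    field_simp at h3
    rw [h3]
    ring
  filter_upwards [eventually_ne_atTop 0,
    (tendsto_factorial_mul_cpow_mul_inv_Gamma r).eventually_ne one_ne_zero] with m hm hg
  have hm' : (m : ℂ) ≠ 0 := Nat.cast_ne_zero.mpr hm
  have hf : (m.factorial : ℂ) ≠ 0 := Nat.cast_ne_zero.mpr m.factorial_ne_zero
  have hG : Complex.Gamma (r + m) ≠ 0 := fun h0 => by simp [h0] at hg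
  have hc : ∀ s : ℂ, (m : ℂ) ^ s ≠ 0 := fun s => by simp [Complex.cpow_eq_zero_iff, hm']
  have e := rising_mul_tsum_gaussCoeff h m
  have e1 : (m : ℂ) ^ (r - p - 1) * (m : ℂ) ^ (r - q - 1)
      = (m : ℂ) ^ (r - p - q - 1) * (m : ℂ) ^ (r - 1) := by
    rw [← natCast_cpow_add hm, ← natCast_cpow_add hm]
    ring_nf
  have c1 := hc (r - p - 1)
  have c2 := hc (r - q - 1)
  have c3 := hc (r - p - q - 1)
  have c4 := hc (r - 1)
  field_simp
  linear_combination (m : ℂ) ^ (r - p - q - 1) * (m : ℂ) ^ (r - 1)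
     * (-e) + rising (r - p - q) m * (∑' n, gaussCoeff p q r n) * e1

/-! ### Asymptotics of Cauchy products -/

theorem rpow_le_two_rpow_abs {t : ℝ} (h1 : 1 / 2 ≤ t) (h2 : t ≤ 2) (s : ℝ) :
    t ^ s ≤ 2 ^ |s| := by
  have ht : 0 < t := by linarith
  rcases le_total 0 s with hs | hs
  · rw [abs_of_nonneg hs]
    exact Real.rpow_le_rpow ht.le h2 hs
  · rw [abs_of_nonpos hs, ← inv_inv t, Real.inv_rpow (by positivity), ← Real.rpow_neg (by positivity)]
    refine Real.rpow_le_rpow (by positivity) ?_ (by linarith)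
    rw [inv_le_comm₀ ht (by norm_num)]
    linarith

theorem tendsto_mul_shifted_cpow {u : ℕ → ℂ} {s U : ℂ}
    (h : Tendsto (fun n : ℕ => u n * (n : ℂ) ^ s) atTop (𝓝 U)) (j : ℕ) :
    Tendsto (fun n : ℕ => u n * ((n + j : ℕ) : ℂ) ^ s) atTop (𝓝 U) := by
  have h1 : Tendsto (fun n : ℕ => (((1 + (j : ℝ) / n : ℝ)) : ℂ) ^ s) atTop (𝓝 ((1 : ℂ) ^ s)) := by
    refine Tendsto.cpow ?_ tendsto_const_nhds (by simp)
    have h2 : Tendsto (fun n : ℕ => 1 + (j : ℝ) / n) atTop (𝓝 (1 + 0)) :=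
      tendsto_const_nhds.add (tendsto_const_div_atTop_nhds_zero_nat _)
    rw [add_zero] at h2
    exact (Complex.continuous_ofReal.tendsto 1).comp h2
  have h2 := h.mul h1
  rw [Complex.one_cpow, mul_one] at h2
  refine h2.congr' ?_
  filter_upwards [eventually_gt_atTop 0] with n hn
  have hn' : (0 : ℝ) < n := Nat.cast_pos.mpr hn
  have e : ((n + j : ℕ) : ℂ) = ((n : ℝ) : ℂ) * ((1 + (j : ℝ) / n : ℝ) : ℂ) := by
    rw [← Complex.ofReal_mul]
    have : (n : ℝ) * (1 + (j : ℝ) / n) = n + j := by field_simp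
    rw [this]
    push_cast
    rfl
  rw [e, Complex.mul_cpow_ofReal_nonneg hn'.le (by positivity), mul_assoc]
  simp

section Convolution

variable {Cu Cv : ℝ} {u v : ℕ → ℂ}

theorem norm_conv_term_le_near {x : ℂ} (hCu : 0 < Cu)
    (hu : ∀ n, ‖u n‖ ≤ Cu * ((n : ℝ) + 1) ^ (x.re - 1))
    (hv : ∀ n, ‖v n‖ ≤ Cv * ((n : ℝ) + 1) ^ (-1 - x.re)) {n j : ℕ} (hn : 0 < n) (hj : 2 * j ≤ n) :
    ‖u (n - j) * v j * (n : ℂ) ^ (1 - x)‖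
      ≤ Cu * 2 ^ |x.re - 1| * (Cv * ((j : ℝ) + 1) ^ (-1 - x.re)) := by
  have hn' : (0 : ℝ) < n := Nat.cast_pos.mpr hn
  have hn1 : (1 : ℝ) ≤ n := by exact_mod_cast hn
  have hj' : 2 * (j : ℝ) ≤ n := by exact_mod_cast hj
  have hc : ((n - j : ℕ) : ℝ) = n - j := Nat.cast_sub (by omega)
  have hj0 : (0 : ℝ) ≤ j := Nat.cast_nonneg j
  have h1 : ‖u (n - j)‖ * (n : ℝ) ^ (1 - x.re) ≤ Cu * 2 ^ |x.re - 1| := by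
    calc ‖u (n - j)‖ * (n : ℝ) ^ (1 - x.re)
        ≤ Cu * (((n - j : ℕ) : ℝ) + 1) ^ (x.re - 1) * (n : ℝ) ^ (1 - x.re) := by gcongr; exact hu _
      _ = Cu * (((n : ℝ) - j + 1) / n) ^ (x.re - 1) := by
          rw [hc, Real.div_rpow (by linarith) hn'.le, ← neg_sub x.re 1, Real.rpow_neg hn'.le]
          ring
      _ ≤ Cu * 2 ^ |x.re - 1| := by
          gcongr
          apply rpow_le_two_rpow_abs
          · rw [le_div_iff₀ hn']; linarith
          · rw [div_le_iff₀ hn']; linarith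
  rw [norm_mul, norm_mul, Complex.norm_natCast_cpow_of_pos hn]
  calc ‖u (n - j)‖ * ‖v j‖ * (n : ℝ) ^ (1 - x).re
      = (‖u (n - j)‖ * (n : ℝ) ^ (1 - x.re)) * ‖v j‖ := by simp; ring
    _ ≤ _ := mul_le_mul h1 (hv j) (norm_nonneg _) (by positivity)

theorem norm_conv_term_le_far {x : ℂ} (hx : 0 < x.re) (hCu : 0 < Cu) (hCv : 0 < Cv)
    (hu : ∀ n, ‖u n‖ ≤ Cu * ((n : ℝ) + 1) ^ (x.re - 1))
    (hv : ∀ n, ‖v n‖ ≤ Cv * ((n : ℝ) + 1) ^ (-1 - x.re)) {n j : ℕ} (hn : 0 < n) (hj : n < 2 * j)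
    (hjn : j ≤ n) :
    ‖u (n - j) * v j * (n : ℂ) ^ (1 - x)‖
      ≤ Cu * Cv * 2 ^ (1 + x.re) * 2 ^ (3 / 2 * x.re) * (n : ℝ) ^ (-(x.re / 2))
        * (((n - j : ℕ) : ℝ) + 1) ^ (-1 - x.re / 2) := by
  have hn' : (0 : ℝ) < n := Nat.cast_pos.mpr hn
  have hn1 : (1 : ℝ) ≤ n := by exact_mod_cast hn
  have hj' : (n : ℝ) ≤ 2 * (j : ℝ) := by exact_mod_cast hj.le
  have hc : ((n - j : ℕ) : ℝ) = n - j := Nat.cast_sub (by omega)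
  have hjn' : (j : ℝ) ≤ n := by exact_mod_cast hjn
  set k : ℕ := n - j with hk
  have hk0 : (0 : ℝ) < (k : ℝ) + 1 := by positivity
  have h1 : ‖v j‖ ≤ Cv * (2 ^ (1 + x.re) * (n : ℝ) ^ (-1 - x.re)) := by
    refine (hv j).trans ?_
    gcongr
    calc ((j : ℝ) + 1) ^ (-1 - x.re) ≤ ((n : ℝ) / 2) ^ (-1 - x.re) :=
          Real.rpow_le_rpow_of_nonpos (by positivity) (by linarith) (by linarith)
      _ = 2 ^ (1 + x.re) * (n : ℝ) ^ (-1 - x.re) := by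
          rw [Real.div_rpow hn'.le (by norm_num), show -1 - x.re = -(1 + x.re) by ring,
            Real.rpow_neg (by norm_num : (0 : ℝ) ≤ 2)]
          field_simp
  have h2 : ‖u k‖ ≤ Cu * (2 ^ (3 / 2 * x.re) * (n : ℝ) ^ (3 / 2 * x.re)
      * ((k : ℝ) + 1) ^ (-1 - x.re / 2)) := by
    refine (hu k).trans ?_
    gcongr
    -- Trading `(k + 1) ^ (3/2 Re x)` for `(2n) ^ (3/2 Re x)` leaves a summable power of `k + 1`;
    -- together with the other powers of `n` the total is `n ^ (-Re x / 2)`, which still decays.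
    rw [show x.re - 1 = 3 / 2 * x.re + (-1 - x.re / 2) by ring, Real.rpow_add hk0,
      ← Real.mul_rpow (by norm_num) hn'.le]
    gcongr
    linarith
  rw [norm_mul, norm_mul, Complex.norm_natCast_cpow_of_pos hn]
  calc ‖u k‖ * ‖v j‖ * (n : ℝ) ^ (1 - x).re
      ≤ Cu * (2 ^ (3 / 2 * x.re) * (n : ℝ) ^ (3 / 2 * x.re) * ((k : ℝ) + 1) ^ (-1 - x.re / 2))
        * (Cv * (2 ^ (1 + x.re) * (n : ℝ) ^ (-1 - x.re))) * (n : ℝ) ^ (1 - x).re := by gcongr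
    _ = _ := by
      have e : (n : ℝ) ^ (-(x.re / 2))
          = (n : ℝ) ^ (3 / 2 * x.re) * (n : ℝ) ^ (-1 - x.re) * (n : ℝ) ^ (1 - x).re := by
        rw [← Real.rpow_add hn', ← Real.rpow_add hn']
        congr 1
        simp
        ring
      rw [e]
      ring

/-- If `u n ~ U n ^ (x - 1)`, `v n = O (n ^ (-1 - x))` and `0 < Re x`, then the Cauchy product of
`u` and `v` is asymptotic to `(U ∑ v) n ^ (x - 1)`. -/
theorem tendsto_cauchyProduct {x U : ℂ} (hx : 0 < x.re)
    (hu : Tendsto (fun n : ℕ => u n * (n : ℂ) ^ (1 - x)) atTop (𝓝 U))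
    (hCv : 0 < Cv) (hv : ∀ n, ‖v n‖ ≤ Cv * ((n : ℝ) + 1) ^ (-1 - x.re)) :
    Tendsto (fun n : ℕ => (∑ ij ∈ Finset.HasAntidiagonal.antidiagonal n, u ij.1 * v ij.2) * (n : ℂ) ^ (1 - x))
      atTop (𝓝 (U * ∑' n, v n)) := by
  obtain ⟨Cu, hCu, hub⟩ := exists_bound_of_tendsto_mul_cpow hu
  have hub : ∀ n, ‖u n‖ ≤ Cu * ((n : ℝ) + 1) ^ (x.re - 1) := fun n =>
    (hub n).trans_eq (by simp)
  -- Terms with `2 * j ≤ n` are handled by dominated convergence and give the limit; the others add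
  -- up to a null sequence.
  set near : ℕ → ℕ → ℂ := fun n j => if 2 * j ≤ n then u (n - j) * v j * (n : ℂ) ^ (1 - x) else 0
    with hnear
  set far : ℕ → ℕ → ℂ := fun n j => if 2 * j ≤ n then 0 else u (n - j) * v j * (n : ℂ) ^ (1 - x)
    with hfar
  have hsplit : ∀ n : ℕ, (∑ ij ∈ Finset.HasAntidiagonal.antidiagonal n, u ij.1 * v ij.2) * (n : ℂ) ^ (1 - x)
      = ∑' j, near n j + ∑ j ∈ Finset.range (n + 1), far n j := by
    intro n
    rw [← Finset.Nat.sum_antidiagonal_swap, Finset.Nat.sum_antidiagonal_eq_sum_range_succ_mk,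
      Finset.sum_mul, tsum_eq_sum (s := Finset.range (n + 1)), ← Finset.sum_add_distrib]
    · refine Finset.sum_congr rfl fun j _ => ?_
      by_cases h : 2 * j ≤ n <;> simp [hnear, hfar, h, Prod.swap]
    · intro j hj
      have : ¬ 2 * j ≤ n := by simp at hj; omega
      simp [hnear, this]
  have hN : Tendsto (fun n => ∑' j, near n j) atTop (𝓝 (∑' j, U * v j)) := by
    refine tendsto_tsum_of_dominated_convergence
      (bound := fun j : ℕ => Cu * 2 ^ |x.re - 1| * (Cv * ((j : ℝ) + 1) ^ (-1 - x.re))) ?_ ?_ ?_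
    · exact ((summable_natCast_add_one_rpow (by linarith)).mul_left _).mul_left _
    · intro j
      have h1 := (tendsto_mul_shifted_cpow hu j).mul_const (v j)
      have h2 : Tendsto (fun n : ℕ => u (n - j) * v j * (n : ℂ) ^ (1 - x)) atTop (𝓝 (U * v j)) := by
        rw [← tendsto_add_atTop_iff_nat j]
        refine h1.congr fun n => ?_
        rw [Nat.add_sub_cancel]
        ring
      refine h2.congr' ?_
      filter_upwards [eventually_ge_atTop (2 * j)] with n hn
      simp [hnear, hn]
    · filter_upwards [eventually_gt_atTop 0] with n hn j
      by_cases h : 2 * j ≤ n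
      · simp only [hnear, h, if_true]
        exact norm_conv_term_le_near hCu hub hv hn h
      · simp only [hnear, h, if_false, norm_zero]
        positivity
  have hF : Tendsto (fun n => ∑ j ∈ Finset.range (n + 1), far n j) atTop (𝓝 0) := by
    set K : ℝ := Cu * Cv * 2 ^ (1 + x.re) * 2 ^ (3 / 2 * x.re) with hK
    have hK0 : 0 < K := by positivity
    have hs : Summable fun n : ℕ => ((n : ℝ) + 1) ^ (-1 - x.re / 2) :=
      summable_natCast_add_one_rpow (by linarith)
    have h1 : Tendsto (fun n : ℕ => K * (n : ℝ) ^ (-(x.re / 2))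
        * ∑' k : ℕ, ((k : ℝ) + 1) ^ (-1 - x.re / 2)) atTop
        (𝓝 (K * 0 * ∑' k : ℕ, ((k : ℝ) + 1) ^ (-1 - x.re / 2))) :=
      (((tendsto_rpow_neg_atTop (by linarith : 0 < x.re / 2)).comp
        tendsto_natCast_atTop_atTop).const_mul K).mul_const _
    rw [mul_zero, zero_mul] at h1
    refine squeeze_zero_norm' ?_ h1
    filter_upwards [eventually_gt_atTop 0] with n hn
    refine (norm_sum_le _ _).trans ?_
    calc ∑ j ∈ Finset.range (n + 1), ‖far n j‖
        ≤ ∑ j ∈ Finset.range (n + 1), K * (n : ℝ) ^ (-(x.re / 2))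
          * (((n + 1 - 1 - j : ℕ) : ℝ) + 1) ^ (-1 - x.re / 2) := by
          refine Finset.sum_le_sum fun j hj => ?_
          by_cases h : 2 * j ≤ n
          · simp only [hfar, h, if_true, norm_zero]
            positivity
          · simp only [hfar, h, if_false]
            exact norm_conv_term_le_far hx hCu hCv hub hv hn (by omega) (by simp at hj; omega)
      _ = K * (n : ℝ) ^ (-(x.re / 2))
          * ∑ k ∈ Finset.range (n + 1), ((k : ℝ) + 1) ^ (-1 - x.re / 2) := by
          rw [← Finset.mul_sum,
            Finset.sum_range_reflect (fun k : ℕ => ((k : ℝ) + 1) ^ (-1 - x.re / 2))]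
      _ ≤ _ := by
          gcongr
          exact hs.sum_le_tsum _ fun k _ => by positivity
  have h := hN.add hF
  rw [tsum_mul_left, add_zero] at h
  exact h.congr fun n => (hsplit n).symm

end Convolution

/-! ### Perturbed first order recurrences -/

/-- Since `1 - t ≤ exp (-t)`, the product of the factors is bounded by the exponential of minus `δ`
times a harmonic sum, which diverges. -/
theorem tendsto_prod_one_sub_div_zero {δ : ℝ} (hδ : 0 < δ) (N : ℕ) {r : ℕ → ℝ}
    (hr : ∀ n ≥ N, r (n + 1) ≤ (1 - δ / (n + 1)) * r n) (h0 : ∀ n, 0 ≤ r n) :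
    Tendsto r atTop (𝓝 0) := by
  have h1 : ∀ n ≥ N, r n ≤ r N * Real.exp (δ * ∑ j ∈ Finset.range N, 1 / ((j : ℝ) + 1))
      * Real.exp (-(δ * ∑ j ∈ Finset.range n, 1 / ((j : ℝ) + 1))) := by
    intro n hn
    induction n, hn using Nat.le_induction with
    | base => rw [mul_assoc, ← Real.exp_add, add_neg_cancel, Real.exp_zero, mul_one]
    | succ n hn ih =>
      calc r (n + 1) ≤ (1 - δ / (n + 1)) * r n := hr n hn
        _ ≤ Real.exp (-(δ / (n + 1))) * r n := by
          gcongr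
          · exact h0 n
          · have := Real.add_one_le_exp (-(δ / ((n : ℝ) + 1)))
            linarith
        _ ≤ Real.exp (-(δ / (n + 1))) * _ :=
          mul_le_mul_of_nonneg_left ih (Real.exp_pos _).le
        _ = _ := by
          rw [Finset.sum_range_succ, mul_add, neg_add, Real.exp_add]
          ring_nf
  have h2 : Tendsto (fun n : ℕ => Real.exp (-(δ * ∑ j ∈ Finset.range n, 1 / ((j : ℝ) + 1)))) atTop
      (𝓝 0) := by
    refine Real.tendsto_exp_atBot.comp (tendsto_neg_atTop_atBot.comp ?_)
    exact Real.tendsto_sum_range_one_div_nat_succ_atTop.const_mul_atTop hδ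
  have h3 := h2.const_mul (r N * Real.exp (δ * ∑ j ∈ Finset.range N, 1 / ((j : ℝ) + 1)))
  rw [mul_zero] at h3
  refine squeeze_zero' (Eventually.of_forall h0) ?_ h3
  filter_upwards [eventually_ge_atTop N] with n hn using h1 n hn

/-- A perturbed first order recurrence `z (n + 1) = (1 - c / n + o (1 / n)) z n + (f + o (1)) / n`
with `0 < Re c` forces `z n` to tend to `f / c`. -/
theorem tendsto_of_first_order_recurrence {z ρ f : ℕ → ℂ} {c F : ℂ} (hc : 0 < c.re)
    (hz : ∀ᶠ n in atTop, z (n + 1) = ρ n * z n + f n / (n + 1))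
    (hρ : Tendsto (fun n : ℕ => ((n : ℂ) + 1) * (1 - ρ n)) atTop (𝓝 c))
    (hf : Tendsto f atTop (𝓝 F)) : Tendsto z atTop (𝓝 (F / c)) := by
  have hc0 : c ≠ 0 := fun h => by simp [h] at hc
  set δ : ℝ := c.re / 2 with hδ
  have hδ0 : 0 < δ := by positivity
  have hρb : ∀ᶠ n : ℕ in atTop, ‖ρ n‖ ≤ 1 - δ / (n + 1) := by
    set w : ℕ → ℂ := fun n => ((n : ℂ) + 1) * (1 - ρ n) with hw
    have h1 : Tendsto (fun n : ℕ => 2 * (w n).re - ‖w n‖ ^ 2 * (1 / ((n : ℝ) + 1))) atTop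
        (𝓝 (2 * c.re - ‖c‖ ^ 2 * 0)) :=
      (((Complex.continuous_re.tendsto c).comp hρ).const_mul 2).sub
        ((hρ.norm.pow 2).mul tendsto_one_div_add_atTop_nhds_zero_nat)
    rw [mul_zero, sub_zero] at h1
    have h2 : Tendsto (fun n : ℕ => δ / ((n : ℝ) + 1)) atTop (𝓝 0) := by
      have := (tendsto_one_div_add_atTop_nhds_zero_nat (𝕜 := ℝ)).const_mul δ
      rw [mul_zero] at this
      exact this.congr fun n => by ring
    filter_upwards [h1.eventually (lt_mem_nhds (show 2 * δ < 2 * c.re by rw [hδ]; linarith)),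
      h2.eventually (gt_mem_nhds zero_lt_one)] with n hn hn2
    have hn0 : (0 : ℝ) < (n : ℝ) + 1 := by positivity
    have hnc : ((n : ℂ) + 1) ≠ 0 := Nat.cast_add_one_ne_zero n
    have e : ρ n = 1 - w n * (((1 / ((n : ℝ) + 1) : ℝ)) : ℂ) := by
      simp only [hw]
      push_cast
      field_simp
      ring
    set t : ℝ := 1 / ((n : ℝ) + 1) with ht
    have ht0 : 0 < t := by positivity
    have hsq : ‖ρ n‖ ^ 2 = 1 - t * (2 * (w n).re - ‖w n‖ ^ 2 * t) := by
      rw [e, Complex.sq_norm, Complex.sq_norm, Complex.normSq_apply, Complex.normSq_apply]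
      simp
      ring
    have hdt : δ / ((n : ℝ) + 1) = δ * t := by rw [ht]; ring
    rw [hdt] at hn2 ⊢
    -- With `t = 1 / (n + 1)`, the square is at most `1 - 2 δ t ≤ (1 - δ t) ^ 2`.
    refine abs_le_of_sq_le_sq' ?_ (by linarith) |>.2
    rw [hsq]
    nlinarith [mul_pos ht0 hδ0, mul_lt_mul_of_pos_left hn ht0, sq_nonneg (δ * t)]
  have hε : Tendsto (fun n : ℕ => f n - ((n : ℂ) + 1) * (1 - ρ n) * (F / c)) atTop (𝓝 0) := by
    have := hf.sub (hρ.mul_const (F / c))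
    rwa [mul_div_cancel₀ _ hc0, sub_self] at this
  rw [tendsto_iff_norm_sub_tendsto_zero, Metric.tendsto_atTop]
  intro ε hε0
  -- Eventually the error term is at most `δ (ε / 2) / (n + 1)`, exactly what the contraction takes
  -- off `ε / 2`; so the excess over `ε / 2` obeys a homogeneous inequality.
  have hev : ∀ᶠ n : ℕ in atTop, max (‖z (n + 1) - F / c‖ - ε / 2) 0
      ≤ (1 - δ / (n + 1)) * max (‖z n - F / c‖ - ε / 2) 0 := by
    filter_upwards [hz, hρb, hε.norm.eventually
      (gt_mem_nhds (show ‖(0 : ℂ)‖ < δ * (ε / 2) by simp; positivity))] with n hn hn1 hn2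
    have hn0 : (0 : ℝ) < (n : ℝ) + 1 := by positivity
    have hnc : ((n : ℂ) + 1) ≠ 0 := Nat.cast_add_one_ne_zero n
    have hpos : 0 ≤ 1 - δ / ((n : ℝ) + 1) := (norm_nonneg _).trans hn1
    refine max_le ?_ (mul_nonneg hpos (le_max_right _ _))
    have e : z (n + 1) - F / c = ρ n * (z n - F / c)
        + (f n - ((n : ℂ) + 1) * (1 - ρ n) * (F / c)) / (n + 1) := by
      rw [hn]
      field_simp
      ring
    have h1 : ‖z (n + 1) - F / c‖ ≤ (1 - δ / (n + 1)) * ‖z n - F / c‖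
        + δ * (ε / 2) / (n + 1) := by
      rw [e]
      refine (norm_add_le _ _).trans ?_
      rw [norm_mul, norm_div]
      have : ‖(n : ℂ) + 1‖ = (n : ℝ) + 1 := by exact_mod_cast Complex.norm_natCast (n + 1)
      rw [this]
      gcongr
    calc ‖z (n + 1) - F / c‖ - ε / 2
        ≤ (1 - δ / (n + 1)) * (‖z n - F / c‖ - ε / 2) := by
          have : (1 - δ / ((n : ℝ) + 1)) * (‖z n - F / c‖ - ε / 2)
            = (1 - δ / (n + 1)) * ‖z n - F / c‖ + δ * (ε / 2) / (n + 1) - ε / 2 := by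
            field_simp
            ring
          linarith
      _ ≤ _ := mul_le_mul_of_nonneg_left (le_max_left _ _) hpos
  obtain ⟨N, hN⟩ := eventually_atTop.mp hev
  have h0 := tendsto_prod_one_sub_div_zero (r := fun n => max (‖z n - F / c‖ - ε / 2) 0) hδ0 N hN fun n => le_max_right _ _
  obtain ⟨M, hM⟩ := eventually_atTop.mp (h0.eventually (gt_mem_nhds (half_pos hε0)))
  refine ⟨M, fun n hn => ?_⟩
  have := (le_max_left _ _).trans_lt (hM n hn)
  rw [dist_zero_right, norm_norm]
  linarith

/-! ### The three-term recurrence for products of Gauss functions -/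

/-- The coefficients of the product of the power series with coefficients `u` and `v`. -/
noncomputable def cauchyProduct (u v : ℕ → ℂ) (n : ℕ) : ℂ :=
  ∑ ij ∈ Finset.HasAntidiagonal.antidiagonal n, u ij.1 * v ij.2

section Recurrence

variable {u v : ℕ → ℂ} {a b y : ℂ}

/-- The weight `ij.1 * (ij.1 + a)` kills the boundary term `ij.1 = 0`, and `hu` lowers the index in
all the others. -/
theorem sum_antidiagonal_shift_left
    (hu : ∀ k : ℕ, ((k : ℂ) + 1) * (k + 1 + a) * u (k + 1) = (k + 1 / 2 + y) * (k + 1 / 2 + y + a) * u k)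
    (φ : ℂ → ℂ) (n : ℕ) :
    ∑ ij ∈ Finset.HasAntidiagonal.antidiagonal (n + 1),
        (ij.1 : ℂ) * (ij.1 + a) * φ ij.1 * (u ij.1 * v ij.2)
      = ∑ ij ∈ Finset.HasAntidiagonal.antidiagonal n,
        ((ij.1 : ℂ) + 1 / 2 + y) * (ij.1 + 1 / 2 + y + a) * φ (ij.1 + 1) * (u ij.1 * v ij.2) := by
  rw [Finset.Nat.sum_antidiagonal_succ]
  simp only [Nat.cast_zero, zero_mul, zero_add]
  refine Finset.sum_congr rfl fun ij _ => ?_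
  push_cast
  linear_combination φ (ij.1 + 1) * v ij.2 * hu ij.1

theorem sum_antidiagonal_shift_right
    (hv : ∀ j : ℕ, ((j : ℂ) + 1) * (j + 1 - a) * v (j + 1)
      = (j + 1 / 2 + b - y) * (j + 1 / 2 - a - b - y) * v j)
    (ψ : ℂ → ℂ) (n : ℕ) :
    ∑ ij ∈ Finset.HasAntidiagonal.antidiagonal (n + 1),
        (ij.2 : ℂ) * (ij.2 - a) * ψ ij.1 * (u ij.1 * v ij.2)
      = ∑ ij ∈ Finset.HasAntidiagonal.antidiagonal n,
        ((ij.2 : ℂ) + 1 / 2 + b - y) * (ij.2 + 1 / 2 - a - b - y) * ψ ij.1 * (u ij.1 * v ij.2) := by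
  rw [Finset.Nat.sum_antidiagonal_succ']
  simp only [Nat.cast_zero, zero_mul, zero_add]
  refine Finset.sum_congr rfl fun ij _ => ?_
  push_cast
  linear_combination ψ ij.1 * u ij.1 * hv ij.2

/-- The three-term recurrence of the Wilson polynomials in the form satisfied by the Taylor
coefficients of the product of two Gauss functions. -/
theorem cauchyProduct_recurrence
    (hu : ∀ k : ℕ, ((k : ℂ) + 1) * (k + 1 + a) * u (k + 1) = (k + 1 / 2 + y) * (k + 1 / 2 + y + a) * u k)
    (hv : ∀ j : ℕ, ((j : ℂ) + 1) * (j + 1 - a) * v (j + 1)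
      = (j + 1 / 2 + b - y) * (j + 1 / 2 - a - b - y) * v j) (m : ℕ) (n : ℂ) (hn : n = m + 1) :
    2 * n * (n + 1) * ((n + 1) ^ 2 - a ^ 2) * cauchyProduct u v (m + 2)
      = n * (2 * n + 1) * (4 * y ^ 2 + (2 * n ^ 2 + 2 * n + 1 - 2 * a ^ 2 - 2 * a * b - 2 * b ^ 2))
          * cauchyProduct u v (m + 1)
        - 2 * (n ^ 2 - b ^ 2) * (n ^ 2 - (a + b) ^ 2) * cauchyProduct u v m := by
  -- A creative-telescoping certificate: multipliers linear in `k`, chosen so that the weights of `u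
  -- k * v j` gathered from the four shifts do not depend on `k` on each antidiagonal `k + j = m +
  -- 2`, `m + 1`, `m`. These weights are the three coefficients of the recurrence.
  set c : ℂ := (n + b) * (n - a - b) with hc
  set φ₁ : ℂ → ℂ := fun k => 2 * n * (3 * (n + 1) - 2 * k - a) with hφ₁
  set ψ₁ : ℂ → ℂ := fun k => 2 * n * (2 * k + (n + 1) + a) with hψ₁
  set φ₀ : ℂ → ℂ := fun k => 2 * (4 * n ^ 2 - 2 * n * (k - 1 / 2 + y) - c - 2 * n * a) with hφ₀
  set ψ₀ : ℂ → ℂ := fun k => 2 * (2 * n * (k + 1 / 2 + y) + c + 2 * n * a) with hψ₀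
  have e1 := sum_antidiagonal_shift_left (v := v) hu φ₁ (m + 1)
  have e2 := sum_antidiagonal_shift_right (u := u) hv ψ₁ (m + 1)
  have e3 := sum_antidiagonal_shift_left (v := v) hu φ₀ m
  have e4 := sum_antidiagonal_shift_right (u := u) hv ψ₀ m
  have hj : ∀ {M : ℕ} {ij : ℕ × ℕ}, ij ∈ Finset.HasAntidiagonal.antidiagonal M →
      (ij.2 : ℂ) = M - ij.1 := by
    intro M ij h
    rw [Finset.HasAntidiagonal.mem_antidiagonal] at h
    rw [← h]
    push_cast
    ring
  have top : 2 * n * (n + 1) * ((n + 1) ^ 2 - a ^ 2) * cauchyProduct u v (m + 2)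
      = ∑ ij ∈ Finset.HasAntidiagonal.antidiagonal (m + 1 + 1),
          (ij.1 : ℂ) * (ij.1 + a) * φ₁ ij.1 * (u ij.1 * v ij.2)
        + ∑ ij ∈ Finset.HasAntidiagonal.antidiagonal (m + 1 + 1),
          (ij.2 : ℂ) * (ij.2 - a) * ψ₁ ij.1 * (u ij.1 * v ij.2) := by
    rw [cauchyProduct, Finset.mul_sum, ← Finset.sum_add_distrib]
    refine Finset.sum_congr rfl fun ij h => ?_
    rw [hj h]
    simp only [hφ₁, hψ₁, hn]
    push_cast
    ring
  have bot : 2 * (n ^ 2 - b ^ 2) * (n ^ 2 - (a + b) ^ 2) * cauchyProduct u v m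
      = ∑ ij ∈ Finset.HasAntidiagonal.antidiagonal m,
          ((ij.1 : ℂ) + 1 / 2 + y) * (ij.1 + 1 / 2 + y + a) * φ₀ (ij.1 + 1) * (u ij.1 * v ij.2)
        + ∑ ij ∈ Finset.HasAntidiagonal.antidiagonal m,
          ((ij.2 : ℂ) + 1 / 2 + b - y) * (ij.2 + 1 / 2 - a - b - y) * ψ₀ ij.1
            * (u ij.1 * v ij.2) := by
    rw [cauchyProduct, Finset.mul_sum, ← Finset.sum_add_distrib]
    refine Finset.sum_congr rfl fun ij h => ?_
    rw [hj h]
    simp only [hφ₀, hψ₀, hc, hn]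
    ring
  have mid : n * (2 * n + 1)
        * (4 * y ^ 2 + (2 * n ^ 2 + 2 * n + 1 - 2 * a ^ 2 - 2 * a * b - 2 * b ^ 2))
          * cauchyProduct u v (m + 1)
      = ∑ ij ∈ Finset.HasAntidiagonal.antidiagonal (m + 1),
          ((ij.1 : ℂ) + 1 / 2 + y) * (ij.1 + 1 / 2 + y + a) * φ₁ (ij.1 + 1) * (u ij.1 * v ij.2)
        + ∑ ij ∈ Finset.HasAntidiagonal.antidiagonal (m + 1),
          ((ij.2 : ℂ) + 1 / 2 + b - y) * (ij.2 + 1 / 2 - a - b - y) * ψ₁ ij.1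
            * (u ij.1 * v ij.2)
        + ∑ ij ∈ Finset.HasAntidiagonal.antidiagonal (m + 1),
          (ij.1 : ℂ) * (ij.1 + a) * φ₀ ij.1 * (u ij.1 * v ij.2)
        + ∑ ij ∈ Finset.HasAntidiagonal.antidiagonal (m + 1),
          (ij.2 : ℂ) * (ij.2 - a) * ψ₀ ij.1 * (u ij.1 * v ij.2) := by
    rw [cauchyProduct, Finset.mul_sum, ← Finset.sum_add_distrib, ← Finset.sum_add_distrib,
      ← Finset.sum_add_distrib]
    refine Finset.sum_congr rfl fun ij h => ?_
    rw [hj h]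
    simp only [hφ₁, hψ₁, hφ₀, hψ₀, hc, hn]
    push_cast
    ring
  linear_combination top + bot - mid + e1 + e2 - e3 - e4

end Recurrence

/-! ### Continuants and termination -/

/-- The denominators `Bₙ` of `a 0 / (b 0 + a 1 / (b 1 + ⋯))`, without termination. -/
noncomputable def contDen (a b : ℕ → ℂ) : ℕ → ℂ
  | 0 => 1
  | 1 => b 0
  | n + 2 => b (n + 1) * contDen a b (n + 1) + a (n + 1) * contDen a b n

/-- The numerators `Aₙ` of `a 0 / (b 0 + a 1 / (b 1 + ⋯))`, without termination. -/
noncomputable def contNum (a b : ℕ → ℂ) : ℕ → ℂ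
  | 0 => 0
  | 1 => a 0
  | n + 2 => b (n + 1) * contNum a b (n + 1) + a (n + 1) * contNum a b n

theorem contFrac_get?_of_ne {a b : ℕ → ℂ} {n : ℕ} (h : ∀ k ≤ n, a k ≠ 0) :
    (contFrac a b).s.get? n = some ⟨a n, b n⟩ := by
  show (if _ then _ else _) = _
  rw [if_pos h]

theorem contFrac_get?_of_eq_zero {a b : ℕ → ℂ} {n : ℕ} (h : a n = 0) :
    (contFrac a b).s.get? n = none := by
  show (if _ then _ else _) = _
  rw [if_neg fun H => H n le_rfl h]

theorem contFrac_dens_nums {a b : ℕ → ℂ} : ∀ {n : ℕ}, (∀ k < n, a k ≠ 0) →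
    (contFrac a b).dens n = contDen a b n ∧ (contFrac a b).nums n = contNum a b n
  | 0, _ => ⟨rfl, rfl⟩
  | 1, h => by
    have hs := contFrac_get?_of_ne (a := a) (b := b) (n := 0) fun k hk => h k (by omega)
    refine ⟨GenContFract.first_den_eq hs, ?_⟩
    rw [GenContFract.first_num_eq hs]
    simp [contFrac, contNum]
  | n + 2, h => by
    have hs := contFrac_get?_of_ne (a := a) (b := b) (n := n + 1) fun k hk => h k (by omega)
    have h0 := contFrac_dens_nums (b := b) (n := n) fun k hk => h k (by omega)
    have h1 := contFrac_dens_nums (b := b) (n := n + 1) fun k hk => h k (by omega)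
    exact ⟨GenContFract.dens_recurrence hs h0.1 h1.1, GenContFract.nums_recurrence hs h0.2 h1.2⟩

theorem hasValue_contFrac_of_ne_zero {a b : ℕ → ℂ} {v : ℂ} (h : ∀ n, a n ≠ 0)
    (hd : ∀ᶠ n in atTop, contDen a b n ≠ 0)
    (hv : Tendsto (fun n => contNum a b n / contDen a b n) atTop (𝓝 v)) :
    HasValue (contFrac a b) v := by
  have e := fun n => contFrac_dens_nums (a := a) (b := b) (n := n) fun k _ => h k
  refine ⟨hd.mono fun n hn => by rwa [(e n).1], hv.congr fun n => ?_⟩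
  rw [GenContFract.conv_eq_num_div_den, (e n).1, (e n).2]

theorem hasValue_contFrac_of_eq_zero {a b : ℕ → ℂ} {N : ℕ} (h : ∀ k < N, a k ≠ 0) (hN : a N = 0)
    (hd : contDen a b N ≠ 0) : HasValue (contFrac a b) (contNum a b N / contDen a b N) := by
  have e := contFrac_dens_nums (b := b) h
  have ht : (contFrac a b).TerminatedAt N := contFrac_get?_of_eq_zero hN
  refine ⟨?_, ?_⟩
  · filter_upwards [eventually_ge_atTop N] with n hn
    rwa [GenContFract.dens_stable_of_terminated hn ht, e.1]
  · refine tendsto_const_nhds.congr' ?_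
    filter_upwards [eventually_ge_atTop N] with n hn
    rw [GenContFract.convs_stable_of_terminated hn ht, GenContFract.conv_eq_num_div_den, e.1, e.2]

theorem contNum_mul_contDen_sub (a b : ℕ → ℂ) (n : ℕ) :
    contNum a b (n + 1) * contDen a b n - contNum a b n * contDen a b (n + 1)
      = (-1) ^ n * ∏ k ∈ Finset.range (n + 1), a k := by
  induction n with
  | zero => simp [contNum, contDen]
  | succ n ih =>
    rw [Finset.prod_range_succ, contNum, contDen, pow_succ]
    linear_combination -a (n + 1) * ih

/-- If the denominator vanished, so would the numerator, and the determinant formula would make a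
product of nonzero partial numerators zero. -/
theorem contDen_ne_zero_of_contNum_eq {a b : ℕ → ℂ} {N : ℕ} {v : ℂ} (h : ∀ k < N, a k ≠ 0)
    (hv : contNum a b N = v * contDen a b N) : contDen a b N ≠ 0 := by
  intro h0
  rw [h0, mul_zero] at hv
  cases N with
  | zero => simp [contDen] at h0
  | succ n =>
    have e := contNum_mul_contDen_sub a b n
    rw [h0, hv, zero_mul, mul_zero, sub_zero] at e
    have hp : ∏ k ∈ Finset.range (n + 1), a k ≠ 0 :=
      Finset.prod_ne_zero_iff.mpr fun k hk => h k (Finset.mem_range.mp hk)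
    exact mul_ne_zero (pow_ne_zero n (by norm_num)) hp e.symm

/-! ### The second fraction and sums of Wilson type -/

/-- The Taylor coefficients of the product of two regularized Gauss functions; up to a factor these
are the Wilson polynomials with parameters `1/2, (1+α)/2, (1+β)/2, (1-α-β)/2`. -/
noncomputable def wilsonSum (α β x : ℂ) : ℕ → ℂ :=
  cauchyProduct (gaussCoeff ((1 + x) / 2) ((1 + x + α) / 2) (1 + α / 2))
    (gaussCoeff ((1 + β - x) / 2) ((1 - α - β - x) / 2) (1 - α / 2))

/-- The factor that makes `wilsonSum` monic in `x ^ 2`. -/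
noncomputable def wilsonScale (α : ℂ) (n : ℕ) : ℂ :=
  4 ^ n * (n.factorial : ℂ) ^ 2 / ((2 * n).factorial : ℂ)
    * (Complex.Gamma (1 + α / 2 + n) * Complex.Gamma (1 - α / 2 + n))

theorem wilsonScale_neg (α : ℂ) (n : ℕ) : wilsonScale (-α) n = wilsonScale α n := by
  rw [wilsonScale, wilsonScale, mul_comm (Complex.Gamma _)]
  ring_nf

theorem wilsonScale_succ {α : ℂ} {n : ℕ} (h1 : 1 + α / 2 + n ≠ 0) (h2 : 1 - α / 2 + n ≠ 0) :
    (2 * n + 1) * wilsonScale α (n + 1)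
      = 2 * (n + 1) * ((n + 1) ^ 2 - (α / 2) ^ 2) * wilsonScale α n := by
  have g1 := Complex.Gamma_add_one _ h1
  have g2 := Complex.Gamma_add_one _ h2
  have hf : (((2 * n).factorial : ℕ) : ℂ) ≠ 0 := Nat.cast_ne_zero.mpr (Nat.factorial_ne_zero _)
  have hn1 : (2 * (n : ℂ) + 1) ≠ 0 := by exact_mod_cast Nat.succ_ne_zero (2 * n)
  have hn2 : (2 * (n : ℂ) + 1 + 1) ≠ 0 := by exact_mod_cast Nat.succ_ne_zero (2 * n + 1)
  rw [wilsonScale, wilsonScale, show 2 * (n + 1) = 2 * n + 1 + 1 by ring, Nat.factorial_succ,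
    Nat.factorial_succ, Nat.factorial_succ, Nat.cast_mul, Nat.cast_mul, Nat.cast_mul]
  push_cast
  rw [← add_assoc, ← add_assoc, g1, g2]
  field_simp
  ring

theorem wilsonSum_recurrence (α β x : ℂ) (m : ℕ) (n : ℂ) (hn : n = m + 1) :
    2 * n * (n + 1) * ((n + 1) ^ 2 - (α / 2) ^ 2) * wilsonSum α β x (m + 2)
      = n * (2 * n + 1) * (x ^ 2 + lam α β (m + 1)) * wilsonSum α β x (m + 1)
        - 2 * (n ^ 2 - (β / 2) ^ 2) * (n ^ 2 - ((α + β) / 2) ^ 2) * wilsonSum α β x m := by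
  have h := cauchyProduct_recurrence (a := α / 2) (b := β / 2) (y := x / 2)
    (u := gaussCoeff ((1 + x) / 2) ((1 + x + α) / 2) (1 + α / 2))
    (v := gaussCoeff ((1 + β - x) / 2) ((1 - α - β - x) / 2) (1 - α / 2)) ?_ ?_ m n hn
  · rw [wilsonSum, lam]
    push_cast
    rw [← hn]
    linear_combination h
  · intro k
    have := gaussCoeff_succ ((1 + x) / 2) ((1 + x + α) / 2) (1 + α / 2) k
    linear_combination this
  · intro k
    have := gaussCoeff_succ ((1 + β - x) / 2) ((1 - α - β - x) / 2) (1 - α / 2) k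
    linear_combination this

/-- The continuants of the second fraction. -/
noncomputable def kDen (α β x : ℂ) : ℕ → ℂ := contDen (kappa α β) fun m => x ^ 2 + lam α β m

/-- The continuants of the second fraction. -/
noncomputable def kNum (α β x : ℂ) : ℕ → ℂ := contNum (kappa α β) fun m => x ^ 2 + lam α β m

theorem kappa_neg {m : ℕ} (hm : m ≠ 0) (α β : ℂ) : kappa (-α) (-β) m = kappa α β m := by
  simp only [kappa, hm, if_false]
  ring

theorem lam_neg (m : ℕ) (α β : ℂ) : lam (-α) (-β) m = lam α β m := by
  simp only [lam]
  ring

theorem kDen_neg (α β x : ℂ) : ∀ n, kDen (-α) (-β) x n = kDen α β x n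
  | 0 => rfl
  | 1 => by simp [kDen, contDen, lam_neg]
  | n + 2 => by
    have h0 := kDen_neg α β x n
    have h1 := kDen_neg α β x (n + 1)
    simp only [kDen, contDen] at h0 h1 ⊢
    rw [h0, h1, lam_neg, kappa_neg n.succ_ne_zero]

/-- The numerators are linear in the leading `kappa α β 0`, the only coefficient that is odd in `(α,
β)`. -/
theorem kNum_neg (α β x : ℂ) : ∀ n, kNum (-α) (-β) x n = -kNum α β x n
  | 0 => by simp [kNum, contNum]
  | 1 => by simp [kNum, contNum, kappa, leadNum]; ring
  | n + 2 => by
    have h0 := kNum_neg α β x n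
    have h1 := kNum_neg α β x (n + 1)
    simp only [kNum, contNum] at h0 h1 ⊢
    rw [h0, h1, lam_neg, kappa_neg n.succ_ne_zero]
    ring

/-- Both sides obey the same three-term recurrence with starting values `1` and `x ^ 2 + λ₀ - σ`.
For `α` not even, the gamma factors of `wilsonScale` have no poles. -/
theorem kDen_sub_kNum_of_not_isEvenInt {α : ℂ} (h : ¬ IsEvenInt α) (β x : ℂ) :
    ∀ n, kDen α β x n - kNum α β x n = wilsonScale α n * wilsonSum α β x n := by
  have hp : ∀ n : ℕ, 1 + α / 2 + n ≠ 0 := fun n h0 =>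
    h ⟨-((n : ℤ) + 1), by push_cast; linear_combination 2 * h0⟩
  have hm : ∀ n : ℕ, 1 - α / 2 + n ≠ 0 := fun n h0 =>
    h ⟨(n : ℤ) + 1, by push_cast; linear_combination (-2) * h0⟩
  have hGp : Complex.Gamma (1 + α / 2) ≠ 0 :=
    Complex.Gamma_ne_zero fun n h0 => hp n (by linear_combination h0)
  have hGm : Complex.Gamma (1 - α / 2) ≠ 0 :=
    Complex.Gamma_ne_zero fun n h0 => hm n (by linear_combination h0)
  have e0 : wilsonScale α 0 * (gaussCoeff ((1 + x) / 2) ((1 + x + α) / 2) (1 + α / 2) 0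
      * gaussCoeff ((1 + β - x) / 2) ((1 - α - β - x) / 2) (1 - α / 2) 0) = 1 := by
    simp only [wilsonScale, gaussCoeff, rising_zero, Nat.cast_zero, add_zero]
    generalize Complex.Gamma (1 + α / 2) = G at *
    generalize Complex.Gamma (1 - α / 2) = G' at *
    simp
    field_simp
  intro n
  induction n using Nat.strong_induction_on with
  | _ n ih =>
    match n, ih with
    | 0, _ => simpa [kDen, kNum, contDen, contNum, wilsonSum, cauchyProduct] using e0.symm
    | 1, _ =>
      have g := wilsonScale_succ (hp 0) (hm 0)
      have u := gaussCoeff_succ ((1 + x) / 2) ((1 + x + α) / 2) (1 + α / 2) 0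
      have v := gaussCoeff_succ ((1 + β - x) / 2) ((1 - α - β - x) / 2) (1 - α / 2) 0
      have hS : wilsonSum α β x 1 = gaussCoeff ((1 + x) / 2) ((1 + x + α) / 2) (1 + α / 2) 0
          * gaussCoeff ((1 + β - x) / 2) ((1 - α - β - x) / 2) (1 - α / 2) 1
          + gaussCoeff ((1 + x) / 2) ((1 + x + α) / 2) (1 + α / 2) 1
          * gaussCoeff ((1 + β - x) / 2) ((1 - α - β - x) / 2) (1 - α / 2) 0 := by
        simp [wilsonSum, cauchyProduct, Finset.Nat.antidiagonal_succ]
      simp only [Nat.cast_zero, mul_zero, zero_add, add_zero, one_mul, mul_one, one_pow] at g u v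
      have hK : kDen α β x 1 - kNum α β x 1 = x ^ 2 + lam α β 0 - leadNum α β := by
        simp [kDen, kNum, contDen, contNum, kappa]
      rw [hK, g, hS, lam, leadNum]
      set u₀ := gaussCoeff ((1 + x) / 2) ((1 + x + α) / 2) (1 + α / 2) 0
      set v₀ := gaussCoeff ((1 + β - x) / 2) ((1 - α - β - x) / 2) (1 - α / 2) 0
      set u₁ := gaussCoeff ((1 + x) / 2) ((1 + x + α) / 2) (1 + α / 2) 1
      set v₁ := gaussCoeff ((1 + β - x) / 2) ((1 - α - β - x) / 2) (1 - α / 2) 1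
      push_cast
      linear_combination -2 * wilsonScale α 0 * ((1 + α / 2) * u₀ * v + (1 - α / 2) * v₀ * u)
        - (x ^ 2 + (2 - α ^ 2 - α * β - β ^ 2) / 2 - α * β * (α + β) / 4) * e0
    | m + 2, ih =>
      have h0 := ih m (by omega)
      have h1 := ih (m + 1) (by omega)
      have g1 := wilsonScale_succ (hp m) (hm m)
      have g2 := wilsonScale_succ (hp (m + 1)) (hm (m + 1))
      have r := wilsonSum_recurrence α β x m _ rfl
      have hn : ((m : ℂ) + 1) ≠ 0 := Nat.cast_add_one_ne_zero m
      have hn1 : (2 * (m : ℂ) + 1) ≠ 0 := by exact_mod_cast Nat.succ_ne_zero (2 * m)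
      have hn2 : (2 * ((m : ℂ) + 1) + 1) ≠ 0 := by exact_mod_cast Nat.succ_ne_zero (2 * m + 2)
      have hrec : kDen α β x (m + 2) - kNum α β x (m + 2)
          = (x ^ 2 + lam α β (m + 1)) * (kDen α β x (m + 1) - kNum α β x (m + 1))
            + kappa α β (m + 1) * (kDen α β x m - kNum α β x m) := by
        simp only [kDen, kNum, contDen, contNum]
        ring
      have hk : (2 * (m : ℂ) + 1) * (2 * ((m : ℂ) + 1) + 1) * kappa α β (m + 1)
          = -4 * (((m : ℂ) + 1) ^ 2 - (α / 2) ^ 2) * (((m : ℂ) + 1) ^ 2 - (β / 2) ^ 2)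
            * (((m : ℂ) + 1) ^ 2 - ((α + β) / 2) ^ 2) := by
        have hn1' : 2 * ((m : ℂ) + 1) - 1 ≠ 0 := by convert hn1 using 1; ring
        simp only [kappa, Nat.succ_ne_zero, if_false]
        push_cast
        field_simp
        ring
      push_cast at g1 g2
      rw [hrec, h0, h1]
      have hne : ((m : ℂ) + 1) * (2 * (m : ℂ) + 1) * (2 * ((m : ℂ) + 1) + 1) ≠ 0 :=
        mul_ne_zero (mul_ne_zero hn hn1) hn2
      refine mul_left_cancel₀ hne ?_
      linear_combination ((m : ℂ) + 1) * wilsonScale α m * wilsonSum α β x m * hk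
        - (2 * (m : ℂ) + 1) * wilsonScale α (m + 1) * r
        - ((m : ℂ) + 1) * (2 * (m : ℂ) + 1) * wilsonSum α β x (m + 2) * g2
        - 2 * (((m : ℂ) + 1) ^ 2 - (β / 2) ^ 2) * (((m : ℂ) + 1) ^ 2 - ((α + β) / 2) ^ 2)
          * wilsonSum α β x m * g1 * (-1)

/-! ### Extension to even `α` by continuity -/

theorem dense_not_isEvenInt : Dense {α : ℂ | ¬ IsEvenInt α} := by
  have h : {α : ℂ | IsEvenInt α}.Countable :=
    (Set.countable_range fun k : ℤ => 2 * (k : ℂ)).mono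
      (by rintro α ⟨k, hk⟩; exact ⟨k, hk.symm⟩)
  exact h.dense_compl ℂ

theorem continuous_rising (n : ℕ) : Continuous fun s => rising s n := by
  unfold rising
  fun_prop

theorem continuous_gaussCoeff {p q r : ℂ → ℂ} (hp : Continuous p) (hq : Continuous q)
    (hr : Continuous r) (n : ℕ) : Continuous fun z => gaussCoeff (p z) (q z) (r z) n := by
  have h := Complex.differentiable_one_div_Gamma.continuous
  have h1 := h.comp (hr.add continuous_const : Continuous fun z => r z + (n : ℂ))
  exact ((((continuous_rising n).comp hp).mul ((continuous_rising n).comp hq)).div_const _).mul h1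

theorem continuous_wilsonSum (β x : ℂ) (n : ℕ) : Continuous fun α => wilsonSum α β x n := by
  unfold wilsonSum cauchyProduct
  refine continuous_finsetSum _ fun ij _ => ?_
  refine (continuous_gaussCoeff ?_ ?_ ?_ _).mul (continuous_gaussCoeff ?_ ?_ ?_ _) <;> fun_prop

theorem continuous_kappa (β : ℂ) (n : ℕ) : Continuous fun α => kappa α β n := by
  by_cases h : n = 0
  · simp only [kappa, h, if_true, leadNum]
    fun_prop
  · simp only [kappa, h, if_false]
    fun_prop

theorem continuous_lam (β : ℂ) (n : ℕ) : Continuous fun α => lam α β n := by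
  simp only [lam]
  fun_prop

theorem continuous_kDen (β x : ℂ) : ∀ n, Continuous fun α => kDen α β x n
  | 0 => by simpa [kDen, contDen] using continuous_const
  | 1 => by
    have := continuous_lam β 0
    simp only [kDen, contDen]
    fun_prop
  | n + 2 => by
    have h0 := continuous_kDen β x n
    have h1 := continuous_kDen β x (n + 1)
    have h2 := continuous_lam β (n + 1)
    have h3 := continuous_kappa β (n + 1)
    simp only [kDen, contDen] at h0 h1 ⊢
    fun_prop

theorem continuous_kNum (β x : ℂ) : ∀ n, Continuous fun α => kNum α β x n
  | 0 => by simpa [kNum, contNum] using continuous_const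
  | 1 => by simpa [kNum, contNum] using continuous_kappa β 0
  | n + 2 => by
    have h0 := continuous_kNum β x n
    have h1 := continuous_kNum β x (n + 1)
    have h2 := continuous_lam β (n + 1)
    have h3 := continuous_kappa β (n + 1)
    simp only [kNum, contNum] at h0 h1 ⊢
    fun_prop

/-- Both sides are continuous in `α` here, thanks to the regularized coefficients, and non-even
values are dense. For each `α` the two conditions hold for all large `n`, which is enough for
asymptotics. -/
theorem kDen_sub_kNum {α : ℂ} {n : ℕ} (h1 : 0 < (1 + α / 2 + n).re) (h2 : 0 < (1 - α / 2 + n).re)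
    (β x : ℂ) : kDen α β x n - kNum α β x n = wilsonScale α n * wilsonSum α β x n := by
  have hg : ∀ {s : ℂ}, 0 < s.re → ContinuousAt Complex.Gamma s := fun {s} hs => by
    refine Complex.continuousAt_Gamma s fun m hm => ?_
    rw [hm] at hs
    simp at hs
    linarith [(Nat.cast_nonneg m : (0 : ℝ) ≤ m)]
  have hs : ContinuousAt (fun α => wilsonScale α n) α := by
    unfold wilsonScale
    refine continuousAt_const.mul (ContinuousAt.mul ?_ ?_)
    · exact (hg h1).comp (f := fun α : ℂ => 1 + α / 2 + n) (by fun_prop)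
    · exact (hg h2).comp (f := fun α : ℂ => 1 - α / 2 + n) (by fun_prop)
  refine tendsto_nhds_unique_of_frequently_eq
    (((continuous_kDen β x n).sub (continuous_kNum β x n)).tendsto α)
    (hs.mul (continuous_wilsonSum β x n).continuousAt) ?_
  refine (mem_closure_iff_frequently.mp (dense_not_isEvenInt α)).mono fun γ hγ => ?_
  exact kDen_sub_kNum_of_not_isEvenInt hγ β x n

/-! ### Asymptotics of the continuants of the second fraction -/

/-- The reciprocal of the gamma factors of `gammaQuot` with the parameters `(α, β)`. -/
noncomputable def invGammaProd (α β x : ℂ) : ℂ :=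
  (Complex.Gamma ((x + α + 1) / 2))⁻¹ * (Complex.Gamma ((x - α - β + 1) / 2))⁻¹
    * (Complex.Gamma ((x + β + 1) / 2))⁻¹

theorem gammaQuot_eq (α β x : ℂ) :
    gammaQuot α β x = invGammaProd α β x / invGammaProd (-α) (-β) x := by
  simp only [gammaQuot, invGammaProd, sub_neg_eq_add, ← sub_eq_add_neg, div_eq_mul_inv, mul_inv,
    inv_inv]
  ring

/-- The second Gauss function has `r - p - q = x`: for `Re x > 0` its coefficients are summable, and
Gauss's theorem supplies `Γ(x)` and two of the factors of `invGammaProd`. The third comes from the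
leading behaviour of the first Gauss function. -/
theorem tendsto_wilsonSum {x : ℂ} (hx : 0 < x.re) (α β : ℂ) :
    Tendsto (fun n : ℕ => wilsonSum α β x n * (n : ℂ) ^ (1 - x)) atTop
      (𝓝 (Complex.Gamma x * (Complex.Gamma ((1 + x) / 2))⁻¹ * invGammaProd α β x)) := by
  have hu := tendsto_gaussCoeff ((1 + x) / 2) ((1 + x + α) / 2) (1 + α / 2)
  obtain ⟨C, hC, hv⟩ := exists_gaussCoeff_bound ((1 + β - x) / 2) ((1 - α - β - x) / 2) (1 - α / 2)
  have e1 : 1 + (1 + α / 2) - (1 + x) / 2 - (1 + x + α) / 2 = 1 - x := by ring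
  have e2 : ((1 + β - x) / 2).re + ((1 - α - β - x) / 2).re - (1 - α / 2).re - 1 = -1 - x.re := by
    simp
    ring
  have e3 : 1 - α / 2 - (1 + β - x) / 2 - (1 - α - β - x) / 2 = x := by ring
  rw [e1] at hu
  rw [e2] at hv
  have h := tendsto_cauchyProduct hx hu hC hv
  rw [tsum_gaussCoeff (by rw [e3]; exact hx), e3] at h
  have e : Complex.Gamma x * (Complex.Gamma ((1 + x) / 2))⁻¹ * invGammaProd α β x
      = (Complex.Gamma ((1 + x) / 2))⁻¹ * (Complex.Gamma ((1 + x + α) / 2))⁻¹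
        * (Complex.Gamma x * (Complex.Gamma (1 - α / 2 - (1 + β - x) / 2))⁻¹
          * (Complex.Gamma (1 - α / 2 - (1 - α - β - x) / 2))⁻¹) := by
    rw [invGammaProd]
    ring_nf
  rw [e]
  exact h

theorem eventually_re_add_natCast_pos (s : ℂ) : ∀ᶠ n : ℕ in atTop, 0 < (s + n).re := by
  obtain ⟨m, hm⟩ := exists_nat_gt (-s.re)
  filter_upwards [eventually_ge_atTop m] with n hn
  have : (m : ℝ) ≤ n := by exact_mod_cast hn
  simp
  linarith

theorem eventually_wilsonScale_ne_zero (α : ℂ) : ∀ᶠ n in atTop, wilsonScale α n ≠ 0 := by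
  filter_upwards [eventually_re_add_natCast_pos (1 + α / 2),
    eventually_re_add_natCast_pos (1 - α / 2)] with n h1 h2
  have hf : (((2 * n).factorial : ℕ) : ℂ) ≠ 0 := Nat.cast_ne_zero.mpr (Nat.factorial_ne_zero _)
  have hf' : ((n.factorial : ℕ) : ℂ) ≠ 0 := Nat.cast_ne_zero.mpr (Nat.factorial_ne_zero _)
  have g1 := Complex.Gamma_ne_zero_of_re_pos h1
  have g2 := Complex.Gamma_ne_zero_of_re_pos h2
  exact mul_ne_zero (div_ne_zero (mul_ne_zero (pow_ne_zero _ (by norm_num)) (pow_ne_zero _ hf')) hf)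
    (mul_ne_zero g1 g2)

/-- The common growth factor of the continuants of the second fraction. -/
noncomputable def growth (α x : ℂ) (n : ℕ) : ℂ := wilsonScale α n * (n : ℂ) ^ (x - 1)

theorem eventually_growth_ne_zero (α x : ℂ) : ∀ᶠ n in atTop, growth α x n ≠ 0 := by
  filter_upwards [eventually_wilsonScale_ne_zero α, eventually_ne_atTop 0] with n hn hn0
  exact mul_ne_zero hn (by simp [Complex.cpow_eq_zero_iff, hn0])

theorem tendsto_kDen_sub_kNum_div_growth {x : ℂ} (hx : 0 < x.re) (α β : ℂ) :
    Tendsto (fun n => (kDen α β x n - kNum α β x n) / growth α x n) atTop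
      (𝓝 (Complex.Gamma x * (Complex.Gamma ((1 + x) / 2))⁻¹ * invGammaProd α β x)) := by
  refine (tendsto_wilsonSum hx α β).congr' ?_
  filter_upwards [eventually_re_add_natCast_pos (1 + α / 2),
    eventually_re_add_natCast_pos (1 - α / 2), eventually_wilsonScale_ne_zero α,
    eventually_ne_atTop 0] with n h1 h2 h3 hn
  have hn' : (n : ℂ) ≠ 0 := Nat.cast_ne_zero.mpr hn
  rw [kDen_sub_kNum h1 h2, growth, mul_div_mul_left _ _ h3, ← neg_sub x 1, Complex.cpow_neg,
    div_eq_mul_inv]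

theorem tendsto_kDen_add_kNum_div_growth {x : ℂ} (hx : 0 < x.re) (α β : ℂ) :
    Tendsto (fun n => (kDen α β x n + kNum α β x n) / growth α x n) atTop
      (𝓝 (Complex.Gamma x * (Complex.Gamma ((1 + x) / 2))⁻¹ * invGammaProd (-α) (-β) x)) := by
  refine (tendsto_kDen_sub_kNum_div_growth hx (-α) (-β)).congr fun n => ?_
  rw [kDen_neg, kNum_neg, sub_neg_eq_add, growth, growth, wilsonScale_neg]

theorem growth_const_ne_zero {x : ℂ} (hx : 0 < x.re) :
    Complex.Gamma x * (Complex.Gamma ((1 + x) / 2))⁻¹ ≠ 0 := by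
  refine mul_ne_zero (Complex.Gamma_ne_zero_of_re_pos hx)
    (inv_ne_zero (Complex.Gamma_ne_zero_of_re_pos ?_))
  simp
  linarith

theorem tendsto_kDen_div_growth {x : ℂ} (hx : 0 < x.re) (α β : ℂ) :
    Tendsto (fun n => kDen α β x n / growth α x n) atTop
      (𝓝 (Complex.Gamma x * (Complex.Gamma ((1 + x) / 2))⁻¹ / 2
        * (invGammaProd (-α) (-β) x + invGammaProd α β x))) := by
  have h := ((tendsto_kDen_add_kNum_div_growth hx α β).add
    (tendsto_kDen_sub_kNum_div_growth hx α β)).div_const 2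
  convert h using 2
  · ring
  · ring

theorem tendsto_kNum_div_growth {x : ℂ} (hx : 0 < x.re) (α β : ℂ) :
    Tendsto (fun n => kNum α β x n / growth α x n) atTop
      (𝓝 (Complex.Gamma x * (Complex.Gamma ((1 + x) / 2))⁻¹ / 2
        * (invGammaProd (-α) (-β) x - invGammaProd α β x))) := by
  have h := ((tendsto_kDen_add_kNum_div_growth hx α β).sub
    (tendsto_kDen_sub_kNum_div_growth hx α β)).div_const 2
  convert h using 2
  · ring
  · ring

/-! ### The meromorphic function as a quotient of entire functions -/

theorem differentiable_invGammaProd (α β : ℂ) : Differentiable ℂ (invGammaProd α β) := by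
  have h : ∀ c : ℂ → ℂ, Differentiable ℂ c → Differentiable ℂ fun z => (Complex.Gamma (c z))⁻¹ :=
    fun c hc => Complex.differentiable_one_div_Gamma.comp hc
  exact ((h _ (by fun_prop)).mul (h _ (by fun_prop))).mul (h _ (by fun_prop))

theorem invGammaProd_eq_mul_add_two (α β z : ℂ) :
    invGammaProd α β z = (z + α + 1) * (z - α - β + 1) * (z + β + 1) / 8
      * invGammaProd α β (z + 2) := by
  have h := fun c : ℂ => Complex.one_div_Gamma_eq_self_mul_one_div_Gamma_add_one (c / 2)
  have e : ∀ c : ℂ, c / 2 + 1 = (c + 2) / 2 := fun c => by ring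
  simp only [e] at h
  rw [invGammaProd, invGammaProd, h (z + α + 1), h (z - α - β + 1), h (z + β + 1)]
  ring_nf

theorem exists_invGammaProd_ne_zero (α β : ℂ) : ∃ z, invGammaProd α β (z + 2) ≠ 0 := by
  obtain ⟨n, h1, h2, h3⟩ := ((eventually_re_add_natCast_pos (α + 2 + 1)).and
    ((eventually_re_add_natCast_pos (-α - β + 2 + 1)).and
      (eventually_re_add_natCast_pos (β + 2 + 1)))).exists
  have h : ∀ {c : ℂ}, 0 < c.re → (Complex.Gamma (c / 2))⁻¹ ≠ 0 := fun hc =>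
    inv_ne_zero (Complex.Gamma_ne_zero_of_re_pos (by simpa using hc))
  refine ⟨n, mul_ne_zero (mul_ne_zero (h ?_) (h ?_)) (h ?_)⟩
  · convert h1 using 2; ring
  · convert h2 using 2; ring
  · convert h3 using 2; ring

/-- This says that `1 + P` is not identically zero. The cubic factors relating `z` to `z + 2` for
the two signs differ by the constant `αβ(α+β) / 4`. An identically vanishing sum would force this
constant to be `0`; then the two products coincide and each would vanish. -/
theorem exists_invGammaProd_add_ne_zero (α β : ℂ) :
    ∃ z, invGammaProd (-α) (-β) z + invGammaProd α β z ≠ 0 := by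
  by_contra! H
  obtain ⟨z, hz⟩ := exists_invGammaProd_ne_zero α β
  have h0 := H z
  have h1 := H (z + 2)
  rw [invGammaProd_eq_mul_add_two, invGammaProd_eq_mul_add_two α β z] at h0
  have h2 : α * β * (α + β) * invGammaProd α β (z + 2) = 0 := by
    linear_combination (-4 : ℂ) * h0
      + (z - α + 1) * (z + α + β + 1) * (z - β + 1) / 2 * h1
  have h3 : invGammaProd (-α) (-β) (z + 2) = invGammaProd α β (z + 2) := by
    rcases mul_eq_zero.mp ((mul_eq_zero.mp h2).resolve_right hz) with h | h
    · rcases mul_eq_zero.mp h with rfl | rfl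
      · simp only [invGammaProd]
        ring_nf
      · simp only [invGammaProd]
        ring_nf
    · obtain rfl : β = -α := by linear_combination h
      simp only [invGammaProd]
      ring_nf
  rw [h3] at h1
  exact hz (by linear_combination h1 / 2)

theorem eventually_ne_zero_of_differentiable {f : ℂ → ℂ} (hf : Differentiable ℂ f) {z₀ : ℂ}
    (h₀ : f z₀ ≠ 0) (x : ℂ) : ∀ᶠ z in 𝓝[≠] x, f z ≠ 0 := by
  have han : AnalyticOnNhd ℂ f Set.univ := fun z _ => hf.analyticAt z
  refine (hf.analyticAt x).eventually_eq_zero_or_eventually_ne_zero.resolve_left fun h => h₀ ?_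
  exact han.eqOn_zero_of_preconnected_of_eventuallyEq_zero isPreconnected_univ (Set.mem_univ x) h
    (Set.mem_univ z₀)

theorem eventually_meromorphic_mul_eq (α β x : ℂ) : ∀ᶠ z in 𝓝[≠] x,
    (1 - gammaQuot α β z) / (1 + gammaQuot α β z)
        * (invGammaProd (-α) (-β) z + invGammaProd α β z)
      = invGammaProd (-α) (-β) z - invGammaProd α β z
    ∧ invGammaProd (-α) (-β) z + invGammaProd α β z ≠ 0 := by
  obtain ⟨z₁, h₁⟩ := exists_invGammaProd_ne_zero (-α) (-β)
  obtain ⟨z₂, h₂⟩ := exists_invGammaProd_add_ne_zero α β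
  filter_upwards [eventually_ne_zero_of_differentiable (differentiable_invGammaProd (-α) (-β)) h₁ x,
    eventually_ne_zero_of_differentiable ((differentiable_invGammaProd (-α) (-β)).add
      (differentiable_invGammaProd α β)) h₂ x] with z hz1 hz2
  have hz2 : invGammaProd (-α) (-β) z + invGammaProd α β z ≠ 0 := hz2
  refine ⟨?_, hz2⟩
  have h3 : 1 + invGammaProd α β z / invGammaProd (-α) (-β) z ≠ 0 := by
    rw [one_add_div hz1]
    exact div_ne_zero hz2 hz1
  rw [gammaQuot_eq]
  field_simp

theorem eq_mul_of_hasMeromorphicValue {f p q : ℂ → ℂ} {x v : ℂ} (hv : HasMeromorphicValue f x v)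
    (hp : Continuous p) (hq : Continuous q) (h : ∀ᶠ z in 𝓝[≠] x, f z * q z = p z) :
    p x = v * q x :=
  tendsto_nhds_unique ((hp.tendsto x).mono_left nhdsWithin_le_nhds)
    ((hv.mul ((hq.tendsto x).mono_left nhdsWithin_le_nhds)).congr' h)

theorem exists_neg_nat_of_invGammaProd_eq_zero {α β x : ℂ} (h : invGammaProd α β x = 0) :
    ∃ m : ℕ, x + α + 1 = -2 * m ∨ x - α - β + 1 = -2 * m ∨ x + β + 1 = -2 * m := by
  simp only [invGammaProd, mul_eq_zero, inv_eq_zero, Complex.Gamma_eq_zero_iff] at h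
  rcases h with (⟨m, h⟩ | ⟨m, h⟩) | ⟨m, h⟩
  · exact ⟨m, Or.inl (by linear_combination 2 * h)⟩
  · exact ⟨m, Or.inr (Or.inl (by linear_combination 2 * h))⟩
  · exact ⟨m, Or.inr (Or.inr (by linear_combination 2 * h))⟩

/-- A common zero puts one gamma factor of each sign at a pole. Opposite shifts of `x` would add up
to `x + 1 = -(m + k)`, excluded by `Re x > 0`; every other pair subtracts to an even value of `α`,
`β` or `α + β`. -/
theorem isEvenInt_of_invGammaProd_eq_zero {α β x : ℂ} (hx : 0 < x.re)
    (h1 : invGammaProd (-α) (-β) x = 0) (h2 : invGammaProd α β x = 0) :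
    IsEvenInt α ∨ IsEvenInt β ∨ IsEvenInt (α + β) := by
  obtain ⟨m, hm⟩ := exists_neg_nat_of_invGammaProd_eq_zero h1
  obtain ⟨k, hk⟩ := exists_neg_nat_of_invGammaProd_eq_zero h2
  have hno : x + 1 ≠ -(m + k : ℂ) := fun h => by
    have := congrArg Complex.re h
    simp at this
    linarith [(Nat.cast_nonneg m : (0 : ℝ) ≤ m), (Nat.cast_nonneg k : (0 : ℝ) ≤ k)]
  rcases hm with hm | hm | hm <;> rcases hk with hk | hk | hk
  · exact absurd (by linear_combination (hm + hk) / 2) hno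
  · exact Or.inr (Or.inl ⟨(k : ℤ) - m, by push_cast; linear_combination hm - hk⟩)
  · exact Or.inr (Or.inr ⟨(m : ℤ) - k, by push_cast; linear_combination hk - hm⟩)
  · exact Or.inr (Or.inl ⟨(k : ℤ) - m, by push_cast; linear_combination hm - hk⟩)
  · exact absurd (by linear_combination (hm + hk) / 2) hno
  · exact Or.inl ⟨(k : ℤ) - m, by push_cast; linear_combination hm - hk⟩
  · exact Or.inr (Or.inr ⟨(m : ℤ) - k, by push_cast; linear_combination hk - hm⟩)
  · exact Or.inl ⟨(k : ℤ) - m, by push_cast; linear_combination hm - hk⟩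
  · exact absurd (by linear_combination (hm + hk) / 2) hno

section Value

variable {α β x v : ℂ}

theorem invGammaProd_sub_eq (hv : HasMeromorphicValue
      (fun z => (1 - gammaQuot α β z) / (1 + gammaQuot α β z)) x v) :
    invGammaProd (-α) (-β) x - invGammaProd α β x
      = v * (invGammaProd (-α) (-β) x + invGammaProd α β x) := by
  have h1 := (differentiable_invGammaProd (-α) (-β)).continuous
  have h2 := (differentiable_invGammaProd α β).continuous
  exact eq_mul_of_hasMeromorphicValue (p := fun z => invGammaProd (-α) (-β) z - invGammaProd α β z)
    (q := fun z => invGammaProd (-α) (-β) z + invGammaProd α β z) hv (h1.sub h2) (h1.add h2)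
    ((eventually_meromorphic_mul_eq α β x).mono fun z hz => hz.1)

/-- Because the value `v` is finite, a zero of the denominator is also one of the numerator, hence a
common zero of both products. -/
theorem invGammaProd_add_ne_zero (hv : HasMeromorphicValue
      (fun z => (1 - gammaQuot α β z) / (1 + gammaQuot α β z)) x v) (hx : 0 < x.re)
    (hα : ¬ IsEvenInt α) (hβ : ¬ IsEvenInt β) (hαβ : ¬ IsEvenInt (α + β)) :
    invGammaProd (-α) (-β) x + invGammaProd α β x ≠ 0 := by
  intro h
  have e := invGammaProd_sub_eq hv
  rw [h, mul_zero] at e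
  rcases isEvenInt_of_invGammaProd_eq_zero hx (by linear_combination (h + e) / 2)
    (by linear_combination (h - e) / 2) with h | h | h
  exacts [hα h, hβ h, hαβ h]

/-! ### The value of the second fraction -/

theorem contNum_mul_contDen_of_eq_zero {a b : ℕ → ℂ} {N : ℕ} (hN : a N = 0) :
    ∀ j, contNum a b (N + j) * contDen a b N = contNum a b N * contDen a b (N + j)
  | 0 => rfl
  | 1 => by
    cases N with
    | zero => simp [contNum, hN]
    | succ M =>
      rw [show M + 1 + 1 = M + 2 from rfl, contNum, contDen, hN]
      ring
  | j + 2 => by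
    have h0 := contNum_mul_contDen_of_eq_zero (b := b) hN j
    have h1 := contNum_mul_contDen_of_eq_zero (b := b) hN (j + 1)
    rw [← add_assoc] at h1 ⊢
    rw [contNum, contDen]
    linear_combination b (N + j + 1) * h1 + a (N + j + 1) * h0

theorem differentiable_kDen (α β : ℂ) : ∀ n, Differentiable ℂ fun x => kDen α β x n
  | 0 => by simp [kDen, contDen]
  | 1 => by
    simp only [kDen, contDen]
    fun_prop
  | n + 2 => by
    have h0 := differentiable_kDen α β n
    have h1 := differentiable_kDen α β (n + 1)
    simp only [kDen, contDen] at h0 h1 ⊢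
    fun_prop

theorem differentiable_kNum (α β : ℂ) : ∀ n, Differentiable ℂ fun x => kNum α β x n
  | 0 => by simp [kNum, contNum]
  | 1 => by simp [kNum, contNum]
  | n + 2 => by
    have h0 := differentiable_kNum α β n
    have h1 := differentiable_kNum α β (n + 1)
    simp only [kNum, contNum] at h0 h1 ⊢
    fun_prop

/-- After a zero numerator the continuants stay proportional to those at `N`, so for `Re z > 0` the
asymptotics compare `A_N, B_N` with the gamma products. Both sides are entire, which removes the
restriction on `x`. -/
theorem invGammaProd_sub_mul_kDen {N : ℕ} (hN : kappa α β N = 0) (x : ℂ) :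
    (invGammaProd (-α) (-β) x - invGammaProd α β x) * kDen α β x N
      = (invGammaProd (-α) (-β) x + invGammaProd α β x) * kNum α β x N := by
  have hpos : ∀ z : ℂ, 0 < z.re →
      (invGammaProd (-α) (-β) z - invGammaProd α β z) * kDen α β z N
        = (invGammaProd (-α) (-β) z + invGammaProd α β z) * kNum α β z N := by
    intro z hz
    have h1 := (tendsto_kNum_div_growth hz α β).mul_const (kDen α β z N)
    have h2 := (tendsto_kDen_div_growth hz α β).mul_const (kNum α β z N)
    have h3 := tendsto_nhds_unique (h1.congr' ?_) h2
    · refine mul_left_cancel₀ (div_ne_zero (growth_const_ne_zero hz) two_ne_zero) ?_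
      linear_combination h3
    filter_upwards [eventually_ge_atTop N] with n hn
    obtain ⟨j, rfl⟩ := Nat.exists_eq_add_of_le hn
    have e := contNum_mul_contDen_of_eq_zero (b := fun m => z ^ 2 + lam α β m) hN j
    simp only [kNum, kDen]
    rw [div_mul_eq_mul_div, div_mul_eq_mul_div, e, mul_comm]
  have hd1 := differentiable_invGammaProd (-α) (-β)
  have hd2 := differentiable_invGammaProd α β
  have hl : Differentiable ℂ fun z =>
      (invGammaProd (-α) (-β) z - invGammaProd α β z) * kDen α β z N :=
    (hd1.sub hd2).mul (differentiable_kDen α β N)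
  have hr : Differentiable ℂ fun z =>
      (invGammaProd (-α) (-β) z + invGammaProd α β z) * kNum α β z N :=
    (hd1.add hd2).mul (differentiable_kNum α β N)
  refine congrFun (AnalyticOnNhd.eq_of_eventuallyEq (z₀ := (1 : ℂ))
    (fun z _ => hl.analyticAt z) (fun z _ => hr.analyticAt z) ?_) x
  filter_upwards [(isOpen_lt continuous_const Complex.continuous_re).mem_nhds
    (show (0 : ℝ) < (1 : ℂ).re by simp)] with z hz using hpos z hz

theorem kNum_eq_mul_kDen (hv : HasMeromorphicValue
      (fun z => (1 - gammaQuot α β z) / (1 + gammaQuot α β z)) x v) {N : ℕ}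
    (hN : kappa α β N = 0) : kNum α β x N = v * kDen α β x N := by
  refine eq_mul_of_hasMeromorphicValue (p := fun z => kNum α β z N) (q := fun z => kDen α β z N) hv
    (differentiable_kNum α β N).continuous (differentiable_kDen α β N).continuous ?_
  filter_upwards [eventually_meromorphic_mul_eq α β x] with z hz
  refine mul_left_cancel₀ hz.2 ?_
  linear_combination invGammaProd_sub_mul_kDen hN z + kDen α β z N * hz.1

theorem tendsto_kNum_div_kDen (hv : HasMeromorphicValue
      (fun z => (1 - gammaQuot α β z) / (1 + gammaQuot α β z)) x v) (hx : 0 < x.re)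
    (hs : invGammaProd (-α) (-β) x + invGammaProd α β x ≠ 0) :
    (∀ᶠ n in atTop, kDen α β x n ≠ 0) ∧
      Tendsto (fun n => kNum α β x n / kDen α β x n) atTop (𝓝 v) := by
  have hc := div_ne_zero (growth_const_ne_zero hx) (two_ne_zero (α := ℂ))
  have h1 := tendsto_kNum_div_growth hx α β
  have h2 := tendsto_kDen_div_growth hx α β
  have h0 := mul_ne_zero hc hs
  refine ⟨(h2.eventually_ne h0).mono fun n hn h => hn (by rw [h, zero_div]), ?_⟩
  have h3 := h1.div h2 h0
  rw [invGammaProd_sub_eq hv, mul_left_comm, mul_div_cancel_right₀ _ h0] at h3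
  refine h3.congr' ?_
  filter_upwards [eventually_growth_ne_zero α x] with n hn
  exact div_div_div_cancel_right₀ hn _ _

theorem exists_kappa_eq_zero (h : IsEvenInt α ∨ IsEvenInt β ∨ IsEvenInt (α + β)) :
    ∃ N, kappa α β N = 0 := by
  have key : ∀ {k : ℤ}, k ≠ 0 → k.natAbs ≠ 0 ∧ (2 * (k.natAbs : ℂ)) ^ 2 = (2 * (k : ℂ)) ^ 2 := by
    intro k hk
    refine ⟨Int.natAbs_ne_zero.mpr hk, ?_⟩
    have : ((k.natAbs : ℤ) : ℂ) ^ 2 = (k : ℂ) ^ 2 := by exact_mod_cast Int.natAbs_sq k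
    rw [Int.cast_natCast] at this
    rw [mul_pow, mul_pow, this]
  rcases h with ⟨k, hk⟩ | ⟨k, hk⟩ | ⟨k, hk⟩ <;> rcases eq_or_ne k 0 with rfl | hk0
  · exact ⟨0, by simp [kappa, leadNum, hk]⟩
  · exact ⟨k.natAbs, by rw [kappa, if_neg (key hk0).1, (key hk0).2, hk]; simp⟩
  · exact ⟨0, by simp [kappa, leadNum, hk]⟩
  · exact ⟨k.natAbs, by rw [kappa, if_neg (key hk0).1, (key hk0).2, hk]; simp⟩
  · exact ⟨0, by simp [kappa, leadNum, hk]⟩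
  · exact ⟨k.natAbs, by rw [kappa, if_neg (key hk0).1, (key hk0).2, hk]; simp⟩

theorem hasValue_kappa_of_eq_zero (hv : HasMeromorphicValue
      (fun z => (1 - gammaQuot α β z) / (1 + gammaQuot α β z)) x v) (h : ∃ N, kappa α β N = 0) :
    HasValue (contFrac (kappa α β) (fun m => x ^ 2 + lam α β m)) v := by
  classical
  have hlt : ∀ k < Nat.find h, kappa α β k ≠ 0 := fun k hk => Nat.find_min h hk
  have e := kNum_eq_mul_kDen hv (Nat.find_spec h)
  have hd : kDen α β x (Nat.find h) ≠ 0 := contDen_ne_zero_of_contNum_eq hlt e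
  have := hasValue_contFrac_of_eq_zero (b := fun m => x ^ 2 + lam α β m) hlt (Nat.find_spec h) hd
  rwa [(eq_div_iff hd).mpr e.symm]

end Value

/-! ### The first fraction -/

theorem tendsto_of_tendsto_even_odd {X : Type*} {f : ℕ → X} {l : Filter X}
    (he : Tendsto (fun m => f (2 * m)) atTop l) (ho : Tendsto (fun m => f (2 * m + 1)) atTop l) :
    Tendsto f atTop l := by
  intro s hs
  obtain ⟨M, hM⟩ := eventually_atTop.mp (he.eventually hs)
  obtain ⟨M', hM'⟩ := eventually_atTop.mp (ho.eventually hs)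
  refine eventually_atTop.mpr ⟨2 * M + 2 * M' + 1, fun n hn => ?_⟩
  rcases Nat.even_or_odd' n with ⟨m, rfl | rfl⟩
  · exact hM m (by omega)
  · exact hM' m (by omega)

theorem aCoeff_odd (α β : ℂ) (m : ℕ) : aCoeff α β (2 * m + 1)
    = (2 * (m + 1 : ℂ) - α) * (2 * (m + 1 : ℂ) + α + β) * (2 * (m + 1 : ℂ) - β) / 4 := by
  rw [aCoeff, if_neg (by omega), if_neg (by simp)]
  push_cast
  ring

theorem aCoeff_even (α β : ℂ) (m : ℕ) : aCoeff α β (2 * m + 2)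
    = (2 * (m + 1 : ℂ) + α) * (2 * (m + 1 : ℂ) - α - β) * (2 * (m + 1 : ℂ) + β) / 4 := by
  rw [aCoeff, if_neg (by omega), if_pos (by simp [parity_simps])]
  push_cast
  ring

theorem bCoeff_odd (α β x : ℂ) (m : ℕ) : bCoeff α β x (2 * m + 1) = 1 := by
  rw [bCoeff, if_neg (by omega), if_neg (by simp)]

theorem bCoeff_even (α β x : ℂ) (m : ℕ) :
    bCoeff α β x (2 * m + 2) = (x ^ 2 - 1) * (2 * (m + 1) + 1) := by
  rw [bCoeff, if_neg (by omega), if_pos (by simp [parity_simps])]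
  push_cast
  ring

theorem kappa_succ_mul (α β : ℂ) (m : ℕ) : (2 * (m : ℂ) + 1) * (2 * m + 3) * kappa α β (m + 1)
    = -(aCoeff α β (2 * m + 1) * aCoeff α β (2 * m + 2)) := by
  have h1 : (2 * (m : ℂ) + 1) ≠ 0 := by exact_mod_cast Nat.succ_ne_zero (2 * m)
  have h2 : 2 * ((m : ℂ) + 1) - 1 ≠ 0 := by convert h1 using 1; ring
  have h3 : 2 * ((m : ℂ) + 1) + 1 ≠ 0 := by exact_mod_cast Nat.succ_ne_zero (2 * m + 2)
  rw [aCoeff_odd, aCoeff_even, kappa, if_neg m.succ_ne_zero]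
  push_cast
  field_simp
  ring

/-- The double factorial `1 · 3 ⋯ (2m - 1)`. -/
noncomputable def oddFactorial (m : ℕ) : ℂ := ∏ j ∈ Finset.range m, (2 * (j : ℂ) + 1)

theorem oddFactorial_succ (m : ℕ) : oddFactorial (m + 1) = oddFactorial m * (2 * m + 1) := by
  rw [oddFactorial, Finset.prod_range_succ, oddFactorial]

theorem oddFactorial_ne_zero (m : ℕ) : oddFactorial m ≠ 0 :=
  Finset.prod_ne_zero_iff.mpr fun j _ => by exact_mod_cast Nat.succ_ne_zero (2 * j)

/-- The even part of the first fraction is the second fraction, up to equivalence. -/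
theorem even_contraction {α β x : ℂ} {D K : ℕ → ℂ}
    (hD : ∀ n, D (n + 2) = bCoeff α β x (n + 1) * D (n + 1) + aCoeff α β (n + 1) * D n)
    (hK : ∀ n, K (n + 2) = (x ^ 2 + lam α β (n + 1)) * K (n + 1) + kappa α β (n + 1) * K n)
    (h0 : D 0 = K 0) (h1 : D 2 = K 1) (m : ℕ) : D (2 * m) = oddFactorial m * K m := by
  suffices D (2 * m) = oddFactorial m * K m ∧ D (2 * m + 2) = oddFactorial (m + 1) * K (m + 1) from
    this.1
  induction m with
  | zero => simp [h0, h1, oddFactorial]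
  | succ m ih =>
    obtain ⟨i0, i1⟩ := ih
    refine ⟨i1, ?_⟩
    have e1 := hD (2 * m)
    have e2 := hD (2 * m + 1)
    have e3 := hD (2 * m + 2)
    have e3' : D (2 * (m + 1) + 2) = bCoeff α β x (2 * (m + 1) + 1) * D (2 * m + 3)
      + aCoeff α β (2 * (m + 1) + 1) * D (2 * m + 2) := e3
    have e2' : D (2 * m + 3) = bCoeff α β x (2 * m + 2) * D (2 * m + 2)
      + aCoeff α β (2 * m + 2) * D (2 * m + 1) := e2
    have hk := kappa_succ_mul α β m
    have ha : aCoeff α β (2 * (m + 1) + 1) + aCoeff α β (2 * m + 2)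
        + (x ^ 2 - 1) * (2 * (m + 1) + 1) = (2 * m + 3) * (x ^ 2 + lam α β (m + 1)) := by
      rw [aCoeff_odd, aCoeff_even, lam]
      push_cast
      ring
    rw [bCoeff_odd, one_mul] at e3' e1
    rw [bCoeff_even] at e2'
    rw [oddFactorial_succ] at i1
    rw [hK, oddFactorial_succ, oddFactorial_succ, e3', e2']
    push_cast
    linear_combination -aCoeff α β (2 * m + 2) * e1 - aCoeff α β (2 * m + 1) * aCoeff α β (2 * m + 2) * i0
      + ((x ^ 2 - 1) * (2 * (m + 1) + 1) + aCoeff α β (2 * (m + 1) + 1) + aCoeff α β (2 * m + 2)) * i1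
      + oddFactorial m * (2 * m + 1) * K (m + 1) * ha - oddFactorial m * K m * hk

theorem contDen_even (α β x : ℂ) (m : ℕ) :
    contDen (aCoeff α β) (bCoeff α β x) (2 * m) = oddFactorial m * kDen α β x m := by
  refine even_contraction (D := contDen (aCoeff α β) (bCoeff α β x)) (K := kDen α β x) (fun n => rfl)
    (fun n => rfl) rfl ?_ m
  have h1 := aCoeff_odd α β 0
  simp only [mul_zero, zero_add] at h1
  simp [kDen, contDen, h1, bCoeff, leadNum, lam]
  ring

theorem contNum_even (α β x : ℂ) (m : ℕ) :
    contNum (aCoeff α β) (bCoeff α β x) (2 * m) = oddFactorial m * kNum α β x m := by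
  refine even_contraction (D := contNum (aCoeff α β) (bCoeff α β x)) (K := kNum α β x) (fun n => rfl)
    (fun n => rfl) rfl ?_ m
  have h2 := bCoeff_odd α β x 0
  simp only [mul_zero, zero_add] at h2
  simp [kNum, contNum, h2, aCoeff, kappa]

theorem hasValue_aCoeff_of_eq_zero {α β x v : ℂ} (hv : HasMeromorphicValue
      (fun z => (1 - gammaQuot α β z) / (1 + gammaQuot α β z)) x v) (h : ∃ N, kappa α β N = 0) :
    HasValue (contFrac (aCoeff α β) (bCoeff α β x)) v := by
  classical
  have ha : ∃ n, aCoeff α β n = 0 := by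
    obtain ⟨N, hN⟩ := h
    cases N with
    | zero => exact ⟨0, by simpa [kappa, aCoeff] using hN⟩
    | succ m =>
      have e := kappa_succ_mul α β m
      rw [hN, mul_zero, eq_comm, neg_eq_zero, mul_eq_zero] at e
      rcases e with e | e
      exacts [⟨_, e⟩, ⟨_, e⟩]
  have hlt : ∀ k < Nat.find ha, aCoeff α β k ≠ 0 := fun k hk => Nat.find_min ha hk
  have hN := Nat.find_spec ha
  generalize Nat.find ha = N at hlt hN
  obtain ⟨m, hm, hden, hnum⟩ : ∃ m, kappa α β m = 0
      ∧ contDen (aCoeff α β) (bCoeff α β x) N = oddFactorial m * kDen α β x m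
      ∧ contNum (aCoeff α β) (bCoeff α β x) N = oddFactorial m * kNum α β x m := by
    have hne : ∀ m : ℕ, (2 * (m : ℂ) + 1) * (2 * m + 3) ≠ 0 := fun m =>
      mul_ne_zero (by exact_mod_cast Nat.succ_ne_zero (2 * m))
        (by exact_mod_cast Nat.succ_ne_zero (2 * m + 2))
    rcases Nat.even_or_odd' N with ⟨m, rfl | rfl⟩
    · refine ⟨m, ?_, contDen_even α β x m, contNum_even α β x m⟩
      cases m with
      | zero => simpa [kappa, aCoeff] using hN
      | succ m =>
        have e := kappa_succ_mul α β m
        rw [show 2 * m + 2 = 2 * (m + 1) by ring, hN, mul_zero, neg_zero] at e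
        exact (mul_eq_zero.mp e).resolve_left (hne m)
    -- As `b_{2m+1} = 1` and `a_{2m+1} = 0`, the continuants at `2m + 1` equal those at `2m + 2`,
    -- which the even contraction covers.
    · refine ⟨m + 1, ?_, ?_, ?_⟩
      · have e := kappa_succ_mul α β m
        rw [hN, zero_mul, neg_zero] at e
        exact (mul_eq_zero.mp e).resolve_left (hne m)
      · rw [← contDen_even, show 2 * (m + 1) = 2 * m + 2 by ring, contDen, hN, bCoeff_odd]
        ring
      · rw [← contNum_even, show 2 * (m + 1) = 2 * m + 2 by ring, contNum, hN, bCoeff_odd]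
        ring
  have e : contNum (aCoeff α β) (bCoeff α β x) N = v * contDen (aCoeff α β) (bCoeff α β x) N := by
    rw [hnum, hden, kNum_eq_mul_kDen hv hm]
    ring
  have hd := contDen_ne_zero_of_contNum_eq hlt e
  have := hasValue_contFrac_of_eq_zero (b := bCoeff α β x) hlt hN hd
  rwa [(eq_div_iff hd).mpr e.symm]

theorem tendsto_mul_one_sub_cpow (s : ℂ) :
    Tendsto (fun n : ℕ => ((n : ℂ) + 1) * (1 - (1 - 1 / ((n : ℂ) + 1)) ^ s)) atTop (𝓝 s) := by
  have hd : HasDerivAt (fun t : ℂ => (1 - t) ^ s) (-s) 0 := by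
    have h := ((hasDerivAt_id (0 : ℂ)).const_sub 1).cpow_const (c := s) (by simp)
    simpa using h
  rw [hasDerivAt_iff_tendsto_slope_zero] at hd
  have ht : Tendsto (fun n : ℕ => 1 / ((n : ℂ) + 1)) atTop (𝓝[≠] 0) := by
    refine tendsto_nhdsWithin_iff.mpr ⟨tendsto_one_div_add_atTop_nhds_zero_nat,
      Eventually.of_forall fun n => ?_⟩
    exact div_ne_zero one_ne_zero (Nat.cast_add_one_ne_zero n)
  have h := (hd.comp ht).neg
  rw [neg_neg] at h
  refine h.congr fun n => ?_
  simp
  ring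

theorem natCast_cpow_eq_mul (n : ℕ) (s : ℂ) :
    (n : ℂ) ^ s = ((n + 1 : ℕ) : ℂ) ^ s * (1 - 1 / ((n : ℂ) + 1)) ^ s := by
  have hn : (0 : ℝ) < (n : ℝ) + 1 := by positivity
  have e : (n : ℂ) = (((n : ℝ) + 1 : ℝ) : ℂ) * ((n / ((n : ℝ) + 1) : ℝ) : ℂ) := by
    rw [← Complex.ofReal_mul, mul_div_cancel₀ _ hn.ne']
    simp
  have e2 : 1 - 1 / ((n : ℂ) + 1) = ((n / ((n : ℝ) + 1) : ℝ) : ℂ) := by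
    have : (n : ℂ) + 1 ≠ 0 := Nat.cast_add_one_ne_zero n
    push_cast
    field_simp
    ring
  rw [e2]
  conv_lhs => rw [e]
  rw [Complex.mul_cpow_ofReal_nonneg hn.le (by positivity)]
  simp

/-- Two steps of the recurrence give `D (2m + 3)` from `D (2m + 1)` with a forcing term from the
even continuants. After normalization the multiplier is `1 - (x + 1) / m + o(1 / m)` and the forcing
tends to `2 (x² - 1) ℓ`, whence the quotient `2 (x - 1) ℓ`. It degenerates at `x = 1`. -/
theorem tendsto_odd_continuant {α β x ℓ : ℂ} {D K : ℕ → ℂ} (hx : 0 < x.re)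
    (hD : ∀ n, D (n + 2) = bCoeff α β x (n + 1) * D (n + 1) + aCoeff α β (n + 1) * D n)
    (hDK : ∀ m, D (2 * m) = oddFactorial m * K m)
    (hK : Tendsto (fun n => K n / growth α x n) atTop (𝓝 ℓ)) :
    Tendsto (fun m : ℕ => D (2 * m + 1) / (oddFactorial m * growth α x m * (m : ℂ) ^ 2)) atTop
      (𝓝 (2 * (x - 1) * ℓ)) := by
  set s : ℂ := x + 1 with hs
  -- The multiplier is `R m` times the ratio of consecutive powers `m ^ (x + 1)`. Since `1 - R m =
  -- O(1 / m²)`, only that ratio contributes at order `1 / m`.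
  set R : ℕ → ℂ := fun m => ((m : ℂ) + 1 - α / 2 - β / 2) * (m + 1 + β / 2)
    / ((m + 1) * (m + 1 - α / 2)) with hR
  have hinv : Tendsto (fun n : ℕ => 1 / ((n : ℂ) + 1)) atTop (𝓝 0) :=
    tendsto_one_div_add_atTop_nhds_zero_nat
  have hne : ∀ᶠ m : ℕ in atTop, (m : ℂ) + 1 - α / 2 ≠ 0 := by
    filter_upwards [eventually_re_add_natCast_pos (1 - α / 2)] with m hm h
    rw [show 1 - α / 2 + (m : ℂ) = m + 1 - α / 2 by ring, h] at hm
    simp at hm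
  have hne' : ∀ᶠ m : ℕ in atTop, (m : ℂ) + 1 + α / 2 ≠ 0 := by
    filter_upwards [eventually_re_add_natCast_pos (1 + α / 2)] with m hm h
    rw [show 1 + α / 2 + (m : ℂ) = m + 1 + α / 2 by ring, h] at hm
    simp at hm
  have hR0 : Tendsto (fun m : ℕ => ((m : ℂ) + 1) * (1 - R m)) atTop (𝓝 0) := by
    have h1 : Tendsto (fun m : ℕ => β / 2 * (α / 2 + β / 2) * (1 / ((m : ℂ) + 1))
        / (1 - α / 2 * (1 / ((m : ℂ) + 1)))) atTop
        (𝓝 (β / 2 * (α / 2 + β / 2) * 0 / (1 - α / 2 * 0))) :=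
      (hinv.const_mul _).div ((hinv.const_mul _).const_sub 1) (by simp)
    rw [mul_zero, zero_div] at h1
    refine h1.congr' ?_
    filter_upwards [hne] with m hm
    have hm1 : (m : ℂ) + 1 ≠ 0 := Nat.cast_add_one_ne_zero m
    have hm2 : 1 - α / 2 * (1 / ((m : ℂ) + 1)) ≠ 0 := by
      have : 1 - α / 2 * (1 / ((m : ℂ) + 1)) = (m + 1 - α / 2) / (m + 1) := by field_simp
      rw [this]
      exact div_ne_zero hm hm1
    have hm3 : 2 * ((m : ℂ) + 1) - α ≠ 0 := fun h => hm (by linear_combination h / 2)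
    rw [div_eq_iff hm2]
    simp only [hR]
    field_simp
    ring
  have hR1 : Tendsto R atTop (𝓝 1) := by
    have h := (hR0.mul hinv).const_sub 1
    rw [mul_zero, sub_zero] at h
    refine h.congr fun m => ?_
    have hm1 : (m : ℂ) + 1 ≠ 0 := Nat.cast_add_one_ne_zero m
    field_simp
    ring
  have hρ : Tendsto (fun m : ℕ => ((m : ℂ) + 1) * (1 - R m * (1 - 1 / ((m : ℂ) + 1)) ^ s)) atTop
      (𝓝 s) := by
    have h := hR0.add (hR1.mul (tendsto_mul_one_sub_cpow s))
    rw [zero_add, one_mul] at h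
    exact h.congr fun m => by ring
  have hf : Tendsto (fun m : ℕ => (x ^ 2 - 1) * (2 + 1 / ((m : ℂ) + 1))
      * (K (m + 1) / growth α x (m + 1))) atTop (𝓝 ((x ^ 2 - 1) * (2 + 0) * ℓ)) :=
    ((hinv.const_add 2).const_mul _).mul ((tendsto_add_atTop_iff_nat 1).mpr hK)
  have hsre : 0 < s.re := by
    simp [hs]
    linarith
  have hs0 : s ≠ 0 := fun h => by simp [h] at hsre
  have hlim : (x ^ 2 - 1) * (2 + 0) * ℓ / s = 2 * (x - 1) * ℓ := by
    rw [div_eq_iff hs0, hs]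
    ring
  rw [← hlim]
  refine tendsto_of_first_order_recurrence hsre ?_ hρ hf
  filter_upwards [hne, hne', eventually_growth_ne_zero α x, eventually_ne_atTop 0,
    (tendsto_add_atTop_nat 1).eventually (eventually_growth_ne_zero α x)] with m h1 h2 h3 hm h4
  have hm0 : (m : ℂ) ≠ 0 := Nat.cast_ne_zero.mpr hm
  have hm1 : (m : ℂ) + 1 ≠ 0 := Nat.cast_add_one_ne_zero m
  have hm2 : 2 * (m : ℂ) + 1 ≠ 0 := by exact_mod_cast Nat.succ_ne_zero (2 * m)
  have ho := oddFactorial_ne_zero m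
  have g := wilsonScale_succ (α := α) (n := m) (by convert h2 using 1; ring)
    (by convert h1 using 1; ring)
  have hgrow : (2 * (m : ℂ) + 1) * (growth α x (m + 1) * (m + 1) ^ 2) * (1 - 1 / ((m : ℂ) + 1)) ^ s
      = 2 * (m + 1) * ((m + 1) ^ 2 - (α / 2) ^ 2) * (growth α x m * m ^ 2) := by
    have p1 : ∀ k : ℕ, k ≠ 0 → (k : ℂ) ^ s = (k : ℂ) ^ (x - 1) * (k : ℂ) ^ 2 := fun k hk => by
      rw [hs, show x + 1 = (x - 1) + (2 : ℕ) by push_cast; ring, natCast_cpow_add hk,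
        Complex.cpow_natCast]
    have p2 := natCast_cpow_eq_mul m s
    rw [p1 m hm, p1 (m + 1) m.succ_ne_zero] at p2
    push_cast at p2
    rw [growth, growth]
    push_cast
    linear_combination ((m : ℂ) + 1) ^ (x - 1) * (m + 1) ^ 2 * (1 - 1 / ((m : ℂ) + 1)) ^ s * g
      - 2 * (m + 1) * ((m + 1) ^ 2 - (α / 2) ^ 2) * wilsonScale α m * p2
  have eD : D (2 * (m + 1) + 1) = (x ^ 2 - 1) * (2 * (m + 1) + 1) * (oddFactorial (m + 1) * K (m + 1))
      + aCoeff α β (2 * m + 2) * D (2 * m + 1) := by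
    rw [← hDK, ← bCoeff_even α β x m]
    exact hD (2 * m + 1)
  rw [eD, oddFactorial_succ, aCoeff_even]
  simp only [hR]
  push_cast
  generalize growth α x (m + 1) = G' at *
  generalize growth α x m = G at *
  generalize (1 - 1 / ((m : ℂ) + 1)) ^ s = T at *
  generalize oddFactorial m = F at *
  generalize D (2 * m + 1) = d
  generalize K (m + 1) = k
  have hT : T = 2 * (m + 1) * ((m + 1) ^ 2 - (α / 2) ^ 2) * (G * m ^ 2)
      / ((2 * (m : ℂ) + 1) * (G' * (m + 1) ^ 2)) := by
    rw [eq_div_iff (mul_ne_zero hm2 (mul_ne_zero h4 (pow_ne_zero 2 hm1)))]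
    linear_combination hgrow
  rw [hT]
  have h1' : 2 * ((m : ℂ) + 1) - α ≠ 0 := fun h => h1 (by linear_combination h / 2)
  field_simp
  ring

theorem hasValue_aCoeff_of_re_pos {α β x v : ℂ} (hv : HasMeromorphicValue
      (fun z => (1 - gammaQuot α β z) / (1 + gammaQuot α β z)) x v) (hx : 0 < x.re)
    (hs : invGammaProd (-α) (-β) x + invGammaProd α β x ≠ 0) (hx1 : x ≠ 1)
    (h : ∀ N, kappa α β N ≠ 0) : HasValue (contFrac (aCoeff α β) (bCoeff α β x)) v := by
  have ha : ∀ n, aCoeff α β n ≠ 0 := by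
    intro n hn
    rcases Nat.even_or_odd' n with ⟨m, rfl | rfl⟩
    · cases m with
      | zero => exact h 0 (by simpa [kappa, aCoeff] using hn)
      | succ m =>
        have e := kappa_succ_mul α β m
        rw [show 2 * m + 2 = 2 * (m + 1) by ring, hn, mul_zero, neg_zero] at e
        refine mul_ne_zero (mul_ne_zero ?_ ?_) (h (m + 1)) e
        · exact_mod_cast Nat.succ_ne_zero (2 * m)
        · exact_mod_cast Nat.succ_ne_zero (2 * m + 2)
    · have e := kappa_succ_mul α β m
      rw [hn, zero_mul, neg_zero] at e
      refine mul_ne_zero (mul_ne_zero ?_ ?_) (h (m + 1)) e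
      · exact_mod_cast Nat.succ_ne_zero (2 * m)
      · exact_mod_cast Nat.succ_ne_zero (2 * m + 2)
  obtain ⟨hd, hlim⟩ := tendsto_kNum_div_kDen hv hx hs
  have hc := mul_ne_zero (div_ne_zero (growth_const_ne_zero hx) (two_ne_zero (α := ℂ))) hs
  have hA := tendsto_odd_continuant hx (D := contNum (aCoeff α β) (bCoeff α β x))
    (fun n => by rw [contNum]) (contNum_even α β x) (tendsto_kNum_div_growth hx α β)
  have hB := tendsto_odd_continuant hx (D := contDen (aCoeff α β) (bCoeff α β x))
    (fun n => by rw [contDen]) (contDen_even α β x) (tendsto_kDen_div_growth hx α β)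
  have hB0 := mul_ne_zero (mul_ne_zero (two_ne_zero (α := ℂ)) (sub_ne_zero.mpr hx1)) hc
  refine hasValue_contFrac_of_ne_zero ha ?_ ?_
  · refine tendsto_principal.mp (tendsto_of_tendsto_even_odd
      (f := contDen (aCoeff α β) (bCoeff α β x)) (l := 𝓟 {z | z ≠ 0}) ?_ ?_)
    · rw [tendsto_principal]
      filter_upwards [hd] with m hm
      rw [contDen_even]
      exact mul_ne_zero (oddFactorial_ne_zero m) hm
    · rw [tendsto_principal]
      filter_upwards [hB.eventually_ne hB0] with m hm h0
      exact hm (by rw [h0, zero_div])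
  · refine tendsto_of_tendsto_even_odd ?_ ?_
    · refine hlim.congr fun m => ?_
      rw [contNum_even, contDen_even, mul_div_mul_left _ _ (oddFactorial_ne_zero m)]
    · have h3 := hA.div hB hB0
      rw [invGammaProd_sub_eq hv, mul_left_comm _ v, mul_left_comm _ v,
        mul_div_cancel_right₀ _ hB0] at h3
      refine h3.congr' ?_
      filter_upwards [eventually_growth_ne_zero α x, eventually_ne_atTop 0] with m hm hm0
      exact div_div_div_cancel_right₀ (mul_ne_zero (mul_ne_zero (oddFactorial_ne_zero m) hm)
        (pow_ne_zero 2 (Nat.cast_ne_zero.mpr hm0))) _ _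

theorem theorem5 (α β x v : ℂ)
    (hx : 0 < x.re ∨ IsEvenInt α ∨ IsEvenInt β ∨ IsEvenInt (α + β))
    (hv : HasMeromorphicValue
      (fun z => (1 - gammaQuot α β z) / (1 + gammaQuot α β z)) x v) :
    ((x ≠ 1 ∨ IsEvenInt α ∨ IsEvenInt β ∨ IsEvenInt (α + β)) →
        HasValue (contFrac (aCoeff α β) (bCoeff α β x)) v) ∧
      HasValue (contFrac (kappa α β) (fun m => x ^ 2 + lam α β m)) v := by
  by_cases h : ∃ N, kappa α β N = 0
  · exact ⟨fun _ => hasValue_aCoeff_of_eq_zero hv h, hasValue_kappa_of_eq_zero hv h⟩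
  -- Without a zero `κ` none of `α`, `β`, `α + β` is even, so the hypotheses leave `Re x > 0` and,
  -- for the first fraction, `x ≠ 1`.
  · have heven := mt exists_kappa_eq_zero h
    push Not at h heven
    have hre : 0 < x.re := hx.resolve_right (by tauto)
    have hs := invGammaProd_add_ne_zero hv hre heven.1 heven.2.1 heven.2.2
    obtain ⟨hd, hlim⟩ := tendsto_kNum_div_kDen hv hre hs
    exact ⟨fun h1 => hasValue_aCoeff_of_re_pos hv hre hs (h1.resolve_right (by tauto)) h,
      hasValue_contFrac_of_ne_zero h hd hlim⟩
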